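/- \textbf{Setting.} Let $G$ be a connected undirected weighted graph on $n$ vertices, possibly with loops, i.e. a symmetric weight function $w\ge 0$ on pairs of vertices, whose edges are the pairs of positive weight. Let $d_i=\sum_j w(i,j)$, $D_G=\mathrm{diag}(d_1,\dots,d_n)$, $\mathfrak d=\max_i d_i/\min_i d_i$, $P_G[i,j]=w(i,j)/d_i$ (the transition matrix of the random walk), and $M_G=\frac12\bigl(I+D_G^{1/2}P_GD_G^{-1/2}\bigr)$. Let $\Sigma\subset\mathbb R^n$ be the set of vectors obtained by choosing two distinct indices $i,j$ and taking the vector with $i$-th coordinate $-1/\sqrt{1+d_i/d_j}$, $j$-th coordinate $1/\sqrt{1+d_j/d_i}$, and all other coordinates $0$ (so $\Sigma=\emptyset$ if $n=1$). $\|\cdot\|$ is the Euclidean norm. \textbf{Procedure Estimate-norm$(G,k,v,\epsilon,\gamma)$}, for $v\in\Sigma$, an integer $k\ge 0$ and $\epsilon,\gamma\in(0,1]$. Put $\delta=\frac{\epsilon^2\sqrt2}{54(k+1)n\mathfrak d}$, $\zeta=\frac{\gamma}{3n(k+1)}$ and $r=\bigl\lceil\frac{\log(2/\zeta)}{2\delta^2}\bigr\rceil$.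 Let $\ell_1,\ell_2$ be the indices of the positive and of the negative entry of $v$. Set $R=0$. For each vertex $i$: set $Q=0$ and $\kappa_i=\sqrt{\frac{d_{\ell_1}d_{\ell_2}}{(d_{\ell_1}+d_{\ell_2})d_i}}$, and for each $s=0,\dots,k$: (a) estimate $2^{-k}\binom ks$ by the fraction $a$ of $r$ repetitions in which exactly $s$ out of $k$ fresh uniformly random bits are one; (b) run $r$ independent random walks of $s$ steps from $\ell_1$, let $S$ be the number of them that end at $i$, and add $\frac{aS}{r}\kappa_i$ to $Q$; (c) do the same with $\ell_2$ in place of $\ell_1$ and fresh walks, and subtract $\frac{aS}{r}\kappa_i$ from $Q$. Then add $Q^2$ to $R$. After all vertices $i$ have been processed, output $\sqrt R$. \textbf{Model.} The procedure is a program with a fixed finite number of registers, each holding a vertex or a real number, and has free read-only access to $n,k,\epsilon,\gamma$, the entries of $v$ and the degrees $d_i$. Elementary steps are an exact arithmetic operation ($+,-,\times,/,\sqrt{\cdot},\lceil\cdot\rceil$, the logarithm of a quotient of two numbers), a comparison, a random bit, and one step of the random walk on $G$. A register containing the real number $x$ takes $1+|\log_2|x||$ bits (one bit if $x=0$), and a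 vertex register takes $1+\log_2 n$ bits. The space used is the largest total over all registers at any time during the computation. \textbf{Theorem.} There is an absolute constant $C>0$ such that for every $n\ge1$, every connected undirected weighted graph $G$ on $n$ vertices, every $v\in\Sigma$, every integer $k\ge 0$ and all $\epsilon,\gamma\in(0,1]$, Procedure Estimate-norm$(G,k,v,\epsilon,\gamma)$, implemented in this model, outputs with probability at least $1-\gamma$ a number $X$ with $\bigl|X-\|M_G^kv\|\bigr|\le\epsilon$; and, for every outcome of its random choices, the space it uses is at most $$C\Bigl(\log\frac{n\max(k,1)\,\mathfrak d}{\epsilon}+\max\bigl(0,\log\log(1/\gamma)\bigr)\Bigr),$$ where the second term is read as $0$ if $\gamma=1$. -/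

import Mathlib

/-- An undirected weighted graph on the vertices `Fin n`, possibly with loops: a symmetric
nonnegative weight function; `(i, j)` is an edge exactly when `0 < w i j`. -/
structure WeightedGraph (n : ℕ) where
  w : Fin n → Fin n → ℝ
  symm : ∀ i j, w i j = w j i
  nonneg : ∀ i j, 0 ≤ w i j

namespace WeightedGraph

variable {n : ℕ} (G : WeightedGraph n)

/-- Any two vertices are joined by a path of edges (and there is at least one vertex). -/
def Connected : Prop := (SimpleGraph.fromRel fun i j => 0 < G.w i j).Connected

/-- The degree `d_i = ∑_j w(i,j)`. -/
noncomputable def degree (i : Fin n) : ℝ := ∑ j, G.w i j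

/-- The ratio `𝔡` of the largest degree to the smallest degree. -/
noncomputable def degreeRatio : ℝ := (⨆ i, G.degree i) / (⨅ i, G.degree i)

/-- The transition matrix `P_G` of the random walk, `P_G[i,j] = w(i,j)/d_i`. -/
noncomputable def transition : Matrix (Fin n) (Fin n) ℝ :=
  Matrix.of fun i j => G.w i j / G.degree i

/-- `M_G = (I + D^{1/2} P_G D^{-1/2}) / 2`, where `D` is the diagonal matrix of the degrees. -/
noncomputable def lazyMatrix : Matrix (Fin n) (Fin n) ℝ :=
  (1 / 2 : ℝ) • (1 + Matrix.diagonal (fun i => √(G.degree i)) * G.transition *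
    Matrix.diagonal (fun i => (√(G.degree i))⁻¹))

/-- The set `Σ`: for each choice of two distinct indices `i, j`, the vector with `i`-th coordinate
`-1/√(1 + d_i/d_j)`, `j`-th coordinate `1/√(1 + d_j/d_i)`, and all other coordinates zero. -/
def pairVectors : Set (EuclideanSpace ℝ (Fin n)) :=
  {v | ∃ i j : Fin n, i ≠ j ∧
    v i = -(1 / √(1 + G.degree i / G.degree j)) ∧
    v j = 1 / √(1 + G.degree j / G.degree i) ∧
    ∀ l, l ≠ i → l ≠ j → v l = 0}

theorem sum_ofReal_transition (i : Fin n) (h : 0 < G.degree i) :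
    ∑ j, ENNReal.ofReal (G.transition i j) = 1 := by
  rw [← ENNReal.ofReal_sum_of_nonneg]
  · simp only [transition, Matrix.of_apply, ← Finset.sum_div]
    change ENNReal.ofReal (G.degree i / G.degree i) = 1
    rw [div_self h.ne', ENNReal.ofReal_one]
  · intro j _
    exact div_nonneg (G.nonneg i j) h.le

open Classical in
/-- One step of the random walk `P_G` from `i`: the next vertex is `j` with probability
`P_G[i,j]`. (A walk on an isolated vertex stays there.) -/
noncomputable def walkStep (i : Fin n) : PMF (Fin n) :=
  if h : 0 < G.degree i then
    PMF.ofFintype (fun j => ENNReal.ofReal (G.transition i j)) (G.sum_ofReal_transition i h)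
  else PMF.pure i

end WeightedGraph

/-! ### Randomized register programs and their space

A program has finitely many vertex registers and finitely many real registers. It has read-only
access to its input, which is not charged, and performs one exact arithmetic operation at a time.
A real register with content `x` is charged `1 + |log₂ |x||` bits (a zero is charged `1`), so that
numbers of absolute value between `m^{-c}` and `m^c` cost `O(log m)`. -/

namespace RegProg

/-- The read-only input: a graph, a vector, an integer, and a precision and an error parameter. -/
structure Input (n : ℕ) where
  graph : WeightedGraph n
  vec : EuclideanSpace ℝ (Fin n)
  k : ℕ
  eps : ℝ
  gam : ℝ

/-- The contents of the vertex registers `ν` and of the real registers `ρ`, together with the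
largest space that has been in use so far. -/
structure Config (n : ℕ) (ν ρ : Type) where
  vertex : ν → Fin n
  real : ρ → ℝ
  peak : ℝ

/-- The number of bits charged for a real number. -/
noncomputable def bits (x : ℝ) : ℝ := 1 + |Real.logb 2 (|x|)|

/-- The space taken by given register contents; a vertex register is charged as many bits as the
number `n`. -/
noncomputable def space {n : ℕ} {ν ρ : Type} [Fintype ν] [Fintype ρ]
    (_vertex : ν → Fin n) (real : ρ → ℝ) : ℝ :=
  (∑ _x : ν, bits n) + ∑ y : ρ, bits (real y)

/-- All registers are zero at the start. -/
noncomputable def Config.init (n : ℕ) [NeZero n] (ν ρ : Type) [Fintype ν] [Fintype ρ] :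
    Config n ν ρ where
  vertex := fun _ => 0
  real := fun _ => 0
  peak := space (fun _ : ν => (0 : Fin n)) (fun _ : ρ => 0)

/-- Write a real register, and record the space then in use. -/
noncomputable def Config.setReal {n : ℕ} {ν ρ : Type} [Fintype ν] [Fintype ρ] [DecidableEq ρ]
    (c : Config n ν ρ) (y : ρ) (a : ℝ) : Config n ν ρ where
  vertex := c.vertex
  real := Function.update c.real y a
  peak := max c.peak (space c.vertex (Function.update c.real y a))

/-- Write a vertex register, and record the space then in use. -/
noncomputable def Config.setVertex {n : ℕ} {ν ρ : Type} [Fintype ν] [Fintype ρ] [DecidableEq ν]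
    (c : Config n ν ρ) (x : ν) (i : Fin n) : Config n ν ρ where
  vertex := Function.update c.vertex x i
  real := c.real
  peak := max c.peak (space (Function.update c.vertex x i) c.real)

/-- Operands: a natural constant, a real register, or a cell of the input (`n`, `k`, `ε`, `γ`,
the degree of the vertex in a register, the entry of `v` at the vertex in a register). -/
inductive Operand (ν ρ : Type) where
  | const (a : ℕ)
  | reg (y : ρ)
  | size
  | inK
  | inEps
  | inGam
  | deg (x : ν)
  | entry (x : ν)

noncomputable def Operand.eval {n : ℕ} {ν ρ : Type} (I : Input n) (c : Config n ν ρ) :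
    Operand ν ρ → ℝ
  | .const a => a
  | .reg y => c.real y
  | .size => n
  | .inK => I.k
  | .inEps => I.eps
  | .inGam => I.gam
  | .deg x => I.graph.degree (c.vertex x)
  | .entry x => I.vec (c.vertex x)

/-- A single arithmetic operation; `logRatio a b` is the natural logarithm of `a / b`. -/
inductive Arith (ν ρ : Type) where
  | val (a : Operand ν ρ)
  | plus (a b : Operand ν ρ)
  | minus (a b : Operand ν ρ)
  | times (a b : Operand ν ρ)
  | divide (a b : Operand ν ρ)
  | root (a : Operand ν ρ)
  | ceil (a : Operand ν ρ)
  | logRatio (a b : Operand ν ρ)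

noncomputable def Arith.eval {n : ℕ} {ν ρ : Type} (I : Input n) (c : Config n ν ρ) :
    Arith ν ρ → ℝ
  | .val a => a.eval I c
  | .plus a b => a.eval I c + b.eval I c
  | .minus a b => a.eval I c - b.eval I c
  | .times a b => a.eval I c * b.eval I c
  | .divide a b => a.eval I c / b.eval I c
  | .root a => √(a.eval I c)
  | .ceil a => (⌈a.eval I c⌉ : ℝ)
  | .logRatio a b => Real.log (a.eval I c / b.eval I c)

/-- Tests: comparison of two numbers, or equality of two vertex registers. -/
inductive Test (ν ρ : Type) where
  | less (a b : Operand ν ρ)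
  | same (a b : Operand ν ρ)
  | sameVertex (x x' : ν)

def Test.Holds {n : ℕ} {ν ρ : Type} (I : Input n) (c : Config n ν ρ) : Test ν ρ → Prop
  | .less a b => a.eval I c < b.eval I c
  | .same a b => a.eval I c = b.eval I c
  | .sameVertex x x' => c.vertex x = c.vertex x'

/-- Programs.
* `assign y e`: store the result of `e` in the real register `y`;
* `copy x x'`: store the vertex in `x'` in the vertex register `x`;
* `flip y`: store a uniformly random bit in `y`;
* `step x`: replace the vertex in `x` by the result of one step of the random walk from it;
* `skip`: do nothing; `seq p q`: perform `p` and then `q`;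
* `cond t p`: perform `p` if the test `t` holds;
* `loop y b p`: perform `p` with `y = 0, 1, …, b - 1` in turn (`b` is evaluated on entry);
* `forVertex x p`: perform `p` with `x` running through all vertices. -/
inductive Prog (ν ρ : Type) where
  | assign (y : ρ) (e : Arith ν ρ)
  | copy (x x' : ν)
  | flip (y : ρ)
  | step (x : ν)
  | skip
  | seq (p q : Prog ν ρ)
  | cond (t : Test ν ρ) (p : Prog ν ρ)
  | loop (y : ρ) (b : Operand ν ρ) (p : Prog ν ρ)
  | forVertex (x : ν) (p : Prog ν ρ)

/-- Perform the programs of a list one after the other. -/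
def block {ν ρ : Type} (l : List (Prog ν ρ)) : Prog ν ρ := l.foldr Prog.seq Prog.skip

/-- Perform a random step for each element of a list in turn. -/
noncomputable def inTurn {α β : Type} (f : α → β → PMF β) : List α → β → PMF β
  | [], c => PMF.pure c
  | a :: l, c => (f a c).bind (inTurn f l)

open Classical in
/-- The law of the configuration reached by running a program from a given configuration; all
random choices are independent. -/
noncomputable def Prog.exec {n : ℕ} {ν ρ : Type} [Fintype ν] [Fintype ρ]
    [DecidableEq ν] [DecidableEq ρ] (I : Input n) :
    Prog ν ρ → Config n ν ρ → PMF (Config n ν ρ)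
  | .assign y e, c => PMF.pure (c.setReal y (e.eval I c))
  | .copy x x', c => PMF.pure (c.setVertex x (c.vertex x'))
  | .flip y, c => (PMF.uniformOfFintype (Fin 2)).map fun b => c.setReal y (b.val : ℝ)
  | .step x, c => (I.graph.walkStep (c.vertex x)).map fun i => c.setVertex x i
  | .skip, c => PMF.pure c
  | .seq p q, c => (p.exec I c).bind fun c' => q.exec I c'
  | .cond t p, c => if t.Holds I c then p.exec I c else PMF.pure c
  | .loop y b p, c =>
      inTurn (fun (m : ℕ) c' => p.exec I (c'.setReal y (m : ℝ))) (List.range ⌊b.eval I c⌋₊) c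
  | .forVertex x p, c =>
      inTurn (fun (i : Fin n) c' => p.exec I (c'.setVertex x i)) (List.finRange n) c

end RegProg

/-! ### The procedure Estimate-norm -/

namespace EstimateNorm

open RegProg

/-- The vertex registers: the indices `ℓ₁`, `ℓ₂`, the loop vertex `i`, the current position of a
walk, and two auxiliary loop vertices. -/
inductive VReg where
  | l1 | l2 | i | pos | x | y
  deriving DecidableEq

instance : Fintype VReg :=
  ⟨{.l1, .l2, .i, .pos, .x, .y}, by intro z; cases z <;> decide⟩

/-- The real registers. -/
inductive RReg where
  | dd | delta | r | bound | R | Q | coef | s | a | S | tmp | rep | cnt | bit | ones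
  deriving DecidableEq

instance : Fintype RReg :=
  ⟨{.dd, .delta, .r, .bound, .R, .Q, .coef, .s, .a, .S, .tmp, .rep, .cnt, .bit, .ones},
    by intro z; cases z <;> decide⟩

open Operand Arith Test Prog

/-- `dd ← 𝔡`, as the largest ratio of two degrees. -/
def computeRatio : Prog VReg RReg :=
  forVertex .x (forVertex .y (block [
    assign .tmp (divide (deg .x) (deg .y)),
    cond (less (reg .dd) (reg .tmp)) (assign .dd (val (reg .tmp)))]))

/-- `δ ← ε²√2 / (54 (k+1) n 𝔡)`. -/
def computeDelta : Prog VReg RReg :=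
  block [
    assign .delta (times inEps inEps),
    assign .tmp (root (const 2)),
    assign .delta (times (reg .delta) (reg .tmp)),
    assign .delta (divide (reg .delta) (const 54)),
    assign .tmp (plus inK (const 1)),
    assign .delta (divide (reg .delta) (reg .tmp)),
    assign .delta (divide (reg .delta) size),
    assign .delta (divide (reg .delta) (reg .dd))]

/-- `r ← ⌈log(2/ζ) / (2δ²)⌉` for `ζ = γ / (3n(k+1))`, so that `2/ζ = 6n(k+1)/γ`. The number `ζ`
itself is not stored. -/
def computeReps : Prog VReg RReg :=
  block [
    assign .tmp (plus inK (const 1)),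
    assign .tmp (times (reg .tmp) size),
    assign .tmp (times (const 6) (reg .tmp)),
    assign .tmp (logRatio (reg .tmp) inGam),
    assign .r (times (reg .delta) (reg .delta)),
    assign .r (times (const 2) (reg .r)),
    assign .r (divide (reg .tmp) (reg .r)),
    assign .r (ceil (reg .r))]

/-- Find the indices `ℓ₁`, `ℓ₂` of the positive and of the negative entry of `v`. -/
def findPair : Prog VReg RReg :=
  forVertex .x (block [
    cond (less (const 0) (entry .x)) (copy .l1 .x),
    cond (less (entry .x) (const 0)) (copy .l2 .x)])

/-- `coef ← √(d_{ℓ₁} d_{ℓ₂} / ((d_{ℓ₁} + d_{ℓ₂}) d_i))`, computed as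
`√((d_{ℓ₁}/d_i) / (d_{ℓ₁}/d_{ℓ₂} + 1))`. -/
def computeCoef : Prog VReg RReg :=
  block [
    assign .tmp (divide (deg .l1) (deg .i)),
    assign .coef (divide (deg .l1) (deg .l2)),
    assign .coef (plus (reg .coef) (const 1)),
    assign .coef (divide (reg .tmp) (reg .coef)),
    assign .coef (root (reg .coef))]

/-- Estimate `2^{-k} (k choose s)`: repeat `r` times drawing `k` random bits, and let `a` be the
fraction of the repetitions in which exactly `s` of the bits are one. -/
def estimateBinomial : Prog VReg RReg :=
  block [
    assign .a (val (const 0)),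
    loop .rep (reg .r) (block [
      assign .ones (val (const 0)),
      loop .cnt inK (block [
        flip .bit,
        assign .ones (plus (reg .ones) (reg .bit))]),
      cond (same (reg .ones) (reg .s)) (assign .a (plus (reg .a) (const 1)))]),
    assign .a (divide (reg .a) (reg .r))]

/-- Run `r` walks of `s` steps from the vertex in `start`, let `S` be the number of those that end
on `i`, and put `tmp ← (a S / r) coef`. -/
def estimateWalk (start : VReg) : Prog VReg RReg :=
  block [
    assign .S (val (const 0)),
    loop .rep (reg .r) (block [
      copy .pos start,
      loop .cnt (reg .s) (step .pos),
      cond (sameVertex .pos .i) (assign .S (plus (reg .S) (const 1)))]),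
    assign .tmp (times (reg .a) (reg .S)),
    assign .tmp (divide (reg .tmp) (reg .r)),
    assign .tmp (times (reg .tmp) (reg .coef))]

/-- The body of the loop over `s`. -/
def innerBody : Prog VReg RReg :=
  block [
    estimateBinomial,
    estimateWalk .l1,
    assign .Q (plus (reg .Q) (reg .tmp)),
    estimateWalk .l2,
    assign .Q (minus (reg .Q) (reg .tmp))]

/-- The body of the loop over `i`; the loop over `s` from `0` to `k` has `k + 1` rounds. -/
def outerBody : Prog VReg RReg :=
  block [
    assign .Q (val (const 0)),
    computeCoef,
    assign .bound (plus inK (const 1)),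
    loop .s (reg .bound) innerBody,
    assign .tmp (times (reg .Q) (reg .Q)),
    assign .R (plus (reg .R) (reg .tmp))]

/-- The whole procedure; its output is the final content of the register `R`. -/
def program : Prog VReg RReg :=
  block [
    computeRatio,
    computeDelta,
    computeReps,
    findPair,
    assign .R (val (const 0)),
    forVertex .i outerBody,
    assign .R (root (reg .R))]

/-- The law of the final configuration of Estimate-norm`(G, k, v, ε, γ)`. -/
noncomputable def run {n : ℕ} [NeZero n] (G : WeightedGraph n) (k : ℕ)
    (v : EuclideanSpace ℝ (Fin n)) (ε γ : ℝ) : PMF (Config n VReg RReg) :=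
  program.exec ⟨G, v, k, ε, γ⟩ (Config.init n VReg RReg)

end EstimateNorm

/-! Correctness of the target. Conjugation by the square roots of the degrees turns `M_G` into (I +
P)/2, so `M_G^k` is a binomial average of conjugated powers P^s. Reversibility, d_i P^s[i,l] = d_l
P^s[l,i], converts row i into probabilities of walks that end at i. If a and b are the indices of
the positive and the negative entry of v, then √d_a v_a = -√d_b v_b, so both walks receive one
factor κ_i: the i-th coordinate of M_G^k v is κ_i ∑_s 2^{-k} (k choose s) (P^s[a,i] - P^s[b,i])
(`lazyMatrix_pow_apply`, `toEuclideanLin_lazyMatrix_pow`). The procedure samples exactly these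
quantities.

Accuracy. Each of the 3n(k+1) estimates is a mean of r Bernoulli trials and is off by more than δ
with probability at most 2 exp(-2rδ²) ≤ γ/(3n(k+1)), by Hoeffding (`failsWithin_inTurn_hoeffding`);
a union bound costs γ in total (`failure_le`). If nothing fails, each s contributes an error of at
most 4δκ_i to coordinate i (`failsWithin_innerBody`), κ_i ≤ 𝔡, and the passage from coordinates to
the norm costs at most a factor n. The total 4n(k+1)δ𝔡 is at most ε (`deviation_le`).

Space. Tiny nonzero numbers are as expensive as huge ones, so a lower bound is needed as well. For
every outcome, Q equals z/r² · κ_i with an integer z bounded by 2(k+1)r² (`sure_innerBody`); hence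
it is zero or at least κ_i/r² in absolute value. The squares collected in R cannot cancel
(`sumBudget`). With W = n max(k,1) 𝔡/ε · max(1, log(1/γ)), every stored number is therefore zero or
has absolute value between W^{-293} and W^{293}, and log W is exactly the bracket of the space
bound.

Both claims are propagated through the program by invariants: `Sure` for what holds for every
outcome, `FailsWithin` for what holds up to a failure probability. -/

set_option linter.unusedSectionVars false

/-! ### Expectations, failure probabilities and the union bound for discrete laws. -/

namespace PMF

open scoped ENNReal

variable {α β : Type*}

/-- The expectation of a nonnegative function. -/
noncomputable def expect (μ : PMF α) (f : α → ℝ≥0∞) : ℝ≥0∞ := ∑' x, μ x * f x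

/-- `G` holds for every outcome. -/
def Sure (μ : PMF α) (G : α → Prop) : Prop := ∀ x ∈ μ.support, G x

open Classical in
/-- The probability of `G`. -/
noncomputable def prob (μ : PMF α) (G : α → Prop) : ℝ≥0∞ := μ.expect fun x => if G x then 1 else 0

/-- `G` fails with probability at most `η`. -/
def FailsWithin (μ : PMF α) (G : α → Prop) (η : ℝ≥0∞) : Prop := μ.prob (fun x => ¬ G x) ≤ η

theorem expect_pure (a : α) (f : α → ℝ≥0∞) : (PMF.pure a).expect f = f a := by
  classical
  rw [expect, tsum_eq_single a]
  · simp
  · intro b hb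
    simp [hb]

theorem expect_bind (μ : PMF α) (ν : α → PMF β) (f : β → ℝ≥0∞) :
    (μ.bind ν).expect f = μ.expect fun a => (ν a).expect f := by
  simp only [expect, PMF.bind_apply, ← ENNReal.tsum_mul_right, ← ENNReal.tsum_mul_left]
  rw [ENNReal.tsum_comm]
  simp only [mul_assoc]

theorem expect_map (μ : PMF α) (g : α → β) (f : β → ℝ≥0∞) :
    (μ.map g).expect f = μ.expect fun a => f (g a) := by
  rw [← PMF.bind_pure_comp, expect_bind]
  simp only [Function.comp, expect_pure]

theorem expect_mono {μ : PMF α} {f g : α → ℝ≥0∞} (h : ∀ x ∈ μ.support, f x ≤ g x) :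
    μ.expect f ≤ μ.expect g := by
  refine ENNReal.tsum_le_tsum fun x => ?_
  by_cases hx : x ∈ μ.support
  · gcongr
    exact h x hx
  · simp [(μ.apply_eq_zero_iff x).2 hx]

theorem expect_congr {μ : PMF α} {f g : α → ℝ≥0∞} (h : ∀ x ∈ μ.support, f x = g x) :
    μ.expect f = μ.expect g :=
  le_antisymm (expect_mono fun x hx => (h x hx).le) (expect_mono fun x hx => (h x hx).ge)

theorem expect_const (μ : PMF α) (a : ℝ≥0∞) : (μ.expect fun _ => a) = a := by
  rw [expect, ENNReal.tsum_mul_right, μ.tsum_coe, one_mul]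

theorem expect_add (μ : PMF α) (f g : α → ℝ≥0∞) :
    (μ.expect fun x => f x + g x) = μ.expect f + μ.expect g := by
  simp only [expect, mul_add]
  exact ENNReal.tsum_add

theorem expect_const_mul (μ : PMF α) (a : ℝ≥0∞) (f : α → ℝ≥0∞) :
    (μ.expect fun x => a * f x) = a * μ.expect f := by
  simp only [expect, ← ENNReal.tsum_mul_left]
  exact tsum_congr fun x => by ring

theorem expect_fintype [Fintype α] (μ : PMF α) (f : α → ℝ≥0∞) :
    μ.expect f = ∑ x, μ x * f x := tsum_fintype _

theorem prob_eq_toOuterMeasure (μ : PMF α) (G : α → Prop) :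
    μ.prob G = μ.toOuterMeasure {x | G x} := by
  classical
  rw [prob, expect, PMF.toOuterMeasure_apply]
  refine tsum_congr fun x => ?_
  by_cases h : G x <;> simp [h, Set.indicator]

theorem prob_add_prob_not (μ : PMF α) (G : α → Prop) :
    μ.prob G + μ.prob (fun x => ¬ G x) = 1 := by
  rw [prob, prob, ← expect_add]
  refine (expect_congr fun x _ => ?_).trans (μ.expect_const 1)
  by_cases h : G x <;> simp [h]

theorem prob_pure (a : α) (G : α → Prop) [Decidable (G a)] :
    (PMF.pure a).prob G = if G a then 1 else 0 := by
  rw [prob, expect_pure]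
  congr

theorem prob_bind (μ : PMF α) (ν : α → PMF β) (G : β → Prop) :
    (μ.bind ν).prob G = μ.expect fun a => (ν a).prob G := expect_bind _ _ _

theorem prob_mono {μ : PMF α} {F G : α → Prop} (h : ∀ x ∈ μ.support, F x → G x) :
    μ.prob F ≤ μ.prob G := by
  refine expect_mono fun x hx => ?_
  by_cases hF : F x
  · simp [hF, h x hx hF]
  · simp [hF]

theorem prob_congr {μ : PMF α} {F G : α → Prop} (h : ∀ x ∈ μ.support, (F x ↔ G x)) :
    μ.prob F = μ.prob G :=
  le_antisymm (prob_mono fun x hx => (h x hx).1) (prob_mono fun x hx => (h x hx).2)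

theorem prob_le_one (μ : PMF α) (G : α → Prop) : μ.prob G ≤ 1 :=
  (μ.prob_add_prob_not G) ▸ le_self_add

theorem FailsWithin.le_prob {μ : PMF α} {G : α → Prop} {η : ℝ≥0∞} (h : μ.FailsWithin G η) :
    1 - η ≤ μ.prob G := by
  rw [tsub_le_iff_right, ← μ.prob_add_prob_not G]
  gcongr
  exact h

theorem FailsWithin.mono {μ : PMF α} {G H : α → Prop} {η θ : ℝ≥0∞} (h : μ.FailsWithin G η)
    (hGH : ∀ x ∈ μ.support, G x → H x) (hη : η ≤ θ) : μ.FailsWithin H θ :=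
  (prob_mono fun x hx hn hG => hn (hGH x hx hG)).trans (h.trans hη)

theorem failsWithin_zero_iff {μ : PMF α} {G : α → Prop} : μ.FailsWithin G 0 ↔ μ.Sure G := by
  rw [FailsWithin, prob_eq_toOuterMeasure, nonpos_iff_eq_zero, toOuterMeasure_apply_eq_zero_iff,
    Set.disjoint_left]
  simp [Sure]

/-- Union bound for two consecutive random steps. The second bound is required only from states in
which `G` holds, and no independence is used. -/
theorem FailsWithin.bind {μ : PMF α} {ν : α → PMF β} {G : α → Prop} {H : β → Prop}
    {η θ : ℝ≥0∞} (hμ : μ.FailsWithin G η)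
    (hν : ∀ x ∈ μ.support, G x → (ν x).FailsWithin H θ) : (μ.bind ν).FailsWithin H (η + θ) := by
  classical
  rw [FailsWithin, prob_bind]
  calc μ.expect (fun a => (ν a).prob fun x => ¬ H x)
      ≤ μ.expect (fun a => (if ¬ G a then 1 else 0) + θ) := by
        refine expect_mono fun x hx => ?_
        by_cases hG : G x
        · simpa [hG] using show (ν x).prob (fun y => ¬ H y) ≤ θ from hν x hx hG
        · simpa [hG] using le_add_right (prob_le_one _ _)
    _ ≤ η + θ := by
        rw [expect_add, expect_const]
        gcongr
        refine (le_of_eq ?_).trans hμ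
        rw [prob]
        congr! 3

theorem Sure.bind {μ : PMF α} {ν : α → PMF β} {G : α → Prop} {H : β → Prop}
    (hμ : μ.Sure G) (hν : ∀ x, G x → (ν x).Sure H) : (μ.bind ν).Sure H := by
  intro y hy
  obtain ⟨x, hx, hxy⟩ := (PMF.mem_support_bind_iff _ _ _).1 hy
  exact hν x (hμ x hx) y hxy

theorem Sure.mono {μ : PMF α} {G H : α → Prop} (h : μ.Sure G) (hGH : ∀ x, G x → H x) :
    μ.Sure H := fun x hx => hGH x (h x hx)

theorem Sure.and {μ : PMF α} {G H : α → Prop} (h : μ.Sure G) (h' : μ.Sure H) :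
    μ.Sure fun x => G x ∧ H x := fun x hx => ⟨h x hx, h' x hx⟩

theorem FailsWithin.and {μ : PMF α} {G H : α → Prop} {η : ℝ≥0∞} (h : μ.FailsWithin G η)
    (h' : μ.Sure H) : μ.FailsWithin (fun x => G x ∧ H x) η :=
  h.mono (fun x hx hG => ⟨hG, h' x hx⟩) le_rfl

theorem sure_pure {a : α} {G : α → Prop} : (PMF.pure a).Sure G ↔ G a := by
  simp [Sure]

theorem sure_map {μ : PMF α} {g : α → β} {G : β → Prop} :
    (μ.map g).Sure G ↔ μ.Sure fun x => G (g x) := by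
  simp [Sure]

/-- The moment generating function of a Bernoulli variable. -/
theorem _root_.Real.bernoulli_mgf_le {p : ℝ} (h0 : 0 ≤ p) (h1 : p ≤ 1) (t : ℝ) :
    p * Real.exp (t * (1 - p)) + (1 - p) * Real.exp (t * (0 - p)) ≤ Real.exp (t ^ 2 / 8) := by
  let μ : MeasureTheory.Measure Bool := ProbabilityTheory.bernoulliMeasure true false ⟨p, h0, h1⟩
  have hX : ∀ b : Bool, (if b then (1 : ℝ) else 0) ∈ Set.Icc (0 : ℝ) 1 := by
    intro b; cases b <;> simp
  -- Hoeffding's lemma for values in [0, 1]: the variance proxy is (1/2)² = 1/4, hence the exponent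
  -- t²/8.
  have key := (ProbabilityTheory.hasSubgaussianMGF_of_mem_Icc (μ := μ)
    (X := fun b : Bool => if b then (1 : ℝ) else 0) (a := 0) (b := 1)
    (measurable_of_finite _).aemeasurable (Filter.Eventually.of_forall hX)).mgf_le t
  have hint : ∀ f : Bool → ℝ, ∫ b, f b ∂μ = p * f true + (1 - p) * f false := by
    intro f
    rw [ProbabilityTheory.integral_bernoulliMeasure]
    simp
  rw [ProbabilityTheory.mgf, hint, hint] at key
  refine (le_of_eq ?_).trans (key.trans (le_of_eq ?_))
  · simp
  · simp only [sub_zero, nnnorm_one]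
    push_cast
    ring_nf

/-- Hoeffding's bound for a single increment. -/
theorem expect_exp_le {μ : PMF α} {Y : α → ℝ} {p : ℝ} (h0 : 0 ≤ p) (h1 : p ≤ 1)
    (hY : μ.Sure fun x => Y x = 0 ∨ Y x = 1) (hp : μ.prob (fun x => Y x = 1) = ENNReal.ofReal p)
    (t : ℝ) :
    μ.expect (fun x => ENNReal.ofReal (Real.exp (t * (Y x - p)))) ≤
      ENNReal.ofReal (Real.exp (t ^ 2 / 8)) := by
  classical
  have hn : μ.prob (fun x => ¬ Y x = 1) = ENNReal.ofReal (1 - p) := by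
    have := μ.prob_add_prob_not fun x => Y x = 1
    rw [hp] at this
    rw [ENNReal.ofReal_sub _ h0, ENNReal.ofReal_one, ← this,
      ENNReal.add_sub_cancel_left ENNReal.ofReal_ne_top]
  have : μ.expect (fun x => ENNReal.ofReal (Real.exp (t * (Y x - p)))) =
      ENNReal.ofReal (Real.exp (t * (1 - p))) * μ.prob (fun x => Y x = 1) +
      ENNReal.ofReal (Real.exp (t * (0 - p))) * μ.prob (fun x => ¬ Y x = 1) := by
    rw [prob, prob, ← expect_const_mul, ← expect_const_mul, ← expect_add]
    refine expect_congr fun x hx => ?_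
    rcases hY x hx with h | h <;> simp [h]
  rw [this, hp, hn, ← ENNReal.ofReal_mul (Real.exp_nonneg _),
    ← ENNReal.ofReal_mul (Real.exp_nonneg _), ← ENNReal.ofReal_add]
  · refine ENNReal.ofReal_le_ofReal ((le_of_eq ?_).trans (Real.bernoulli_mgf_le h0 h1 t))
    ring
  · positivity
  · have : 0 ≤ 1 - p := by linarith
    positivity

end PMF

/-! ### Iterated random steps: invariants and Hoeffding's inequality. -/

namespace RegProg

open PMF
open scoped ENNReal

variable {α β : Type}

theorem failsWithin_inTurn_range {f : ℕ → β → PMF β} {J : ℕ → β → Prop} {η : ℝ≥0∞} (m : ℕ)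
    (h : ∀ j < m, ∀ b, J j b → (f j b).FailsWithin (J (j + 1)) η) {c : β} (hc : J 0 c) :
    (inTurn f (List.range m) c).FailsWithin (J m) (m * η) := by
  -- The induction peels off the first round, so the range has to start at an arbitrary a.
  have key : ∀ len a : ℕ, a + len = m → ∀ c, J a c →
      (inTurn f (List.range' a len) c).FailsWithin (J m) (len * η) := by
    intro len
    induction len with
    | zero =>
      intro a ha c hc
      obtain rfl : a = m := by omega
      simpa [inTurn, failsWithin_zero_iff, sure_pure] using hc
    | succ len ih =>
      intro a ha c hc
      rw [List.range'_succ, inTurn, Nat.cast_succ, add_comm (len : ℝ≥0∞), add_mul, one_mul]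
      exact (h a (by omega) c hc).bind fun b _ hb => ih (a + 1) (by omega) b hb
  rw [List.range_eq_range']
  exact key m 0 (by omega) c hc

/-- The invariant is indexed by the set of vertices already treated, so that it can speak of sums
over that set. The list of vertices has no repetitions, so each new vertex lies outside the set. -/
theorem failsWithin_inTurn_finRange {n : ℕ} {f : Fin n → β → PMF β} {J : Finset (Fin n) → β → Prop}
    {η : ℝ≥0∞} (h : ∀ s i, i ∉ s → ∀ b, J s b → (f i b).FailsWithin (J (insert i s)) η)
    {c : β} (hc : J ∅ c) :
    (inTurn f (List.finRange n) c).FailsWithin (J Finset.univ) (n * η) := by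
  have key : ∀ l : List (Fin n), l.Nodup → ∀ s : Finset (Fin n), (∀ i ∈ l, i ∉ s) → ∀ c, J s c →
      (inTurn f l c).FailsWithin (J (s ∪ l.toFinset)) (l.length * η) := by
    intro l
    induction l with
    | nil =>
      intro _ s _ c hc
      simpa [inTurn, failsWithin_zero_iff, sure_pure] using hc
    | cons i l ih =>
      intro hl s hs c hc
      rw [List.nodup_cons] at hl
      rw [inTurn, List.length_cons, Nat.cast_succ, add_comm (l.length : ℝ≥0∞), add_mul, one_mul]
      refine (h s i (hs i (by simp)) c hc).bind fun b _ hb => ?_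
      have := ih hl.2 (insert i s) (fun j hj => ?_) b hb
      · convert this using 2
        ext; simp
      · rw [Finset.mem_insert, not_or]
        exact ⟨fun hij => hl.1 (hij ▸ hj), hs j (by simp [hj])⟩
  have := key _ (List.nodup_finRange n) ∅ (by simp) c hc
  rw [List.length_finRange] at this
  refine this.mono (fun x _ hx => ?_) le_rfl
  convert hx
  ext; simp

theorem sure_inTurn_range {f : ℕ → β → PMF β} {J : ℕ → β → Prop} (m : ℕ)
    (h : ∀ j < m, ∀ b, J j b → (f j b).Sure (J (j + 1))) {c : β} (hc : J 0 c) :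
    (inTurn f (List.range m) c).Sure (J m) := by
  have := failsWithin_inTurn_range m (η := 0)
    (fun j hj b hb => failsWithin_zero_iff.2 (h j hj b hb)) hc
  rwa [mul_zero, failsWithin_zero_iff] at this

theorem sure_inTurn_finRange {n : ℕ} {f : Fin n → β → PMF β} {J : Finset (Fin n) → β → Prop}
    (h : ∀ s i, i ∉ s → ∀ b, J s b → (f i b).Sure (J (insert i s))) {c : β} (hc : J ∅ c) :
    (inTurn f (List.finRange n) c).Sure (J Finset.univ) := by
  have := failsWithin_inTurn_finRange (η := 0)
    (fun s i hi b hb => failsWithin_zero_iff.2 (h s i hi b hb)) hc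
  rwa [mul_zero, failsWithin_zero_iff] at this

theorem sure_inTurn {f : α → β → PMF β} {J : β → Prop} (h : ∀ a b, J b → (f a b).Sure J)
    (l : List α) {c : β} (hc : J c) : (inTurn f l c).Sure J := by
  induction l generalizing c with
  | nil => simpa [inTurn, sure_pure] using hc
  | cons a l ih => exact (h a c hc).bind fun b hb => ih hb

section Hoeffding

variable {f : α → β → PMF β} {J : β → Prop} {X : β → ℝ} {p : ℝ}

/-- Each round multiplies the exponential moment by at most exp(t²/8), because the increment has
conditional probability p from every state that satisfies `J`. This replaces independence: the
trials never have to be exhibited as separate random variables. -/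
theorem expect_inTurn_exp_le (h0 : 0 ≤ p) (h1 : p ≤ 1) (hJ : ∀ a b, J b → (f a b).Sure J)
    (hX : ∀ a b, J b → (f a b).Sure fun b' => X b' = X b ∨ X b' = X b + 1)
    (hp : ∀ a b, J b → (f a b).prob (fun b' => X b' = X b + 1) = ENNReal.ofReal p)
    (t : ℝ) (l : List α) {c : β} (hc : J c) :
    (inTurn f l c).expect (fun b => ENNReal.ofReal (Real.exp (t * (X b - X c - l.length * p)))) ≤
      ENNReal.ofReal (Real.exp (l.length * (t ^ 2 / 8))) := by
  induction l generalizing c with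
  | nil => simp [inTurn, expect_pure]
  | cons a l ih =>
    rw [inTurn, expect_bind]
    calc _ ≤ (f a c).expect (fun b => ENNReal.ofReal (Real.exp (l.length * (t ^ 2 / 8))) *
            ENNReal.ofReal (Real.exp (t * ((X b - X c) - p)))) := by
          refine expect_mono fun b hb => ?_
          refine le_trans (le_of_eq ?_) (mul_le_mul_left (ih (hJ a c hc b hb)) _)
          refine Eq.trans ?_ (mul_comm _ _)
          rw [← expect_const_mul]
          refine expect_congr fun b' _ => ?_
          rw [← ENNReal.ofReal_mul (Real.exp_nonneg _), ← Real.exp_add]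
          congr 2
          push_cast [List.length_cons]
          ring
      _ ≤ ENNReal.ofReal (Real.exp (l.length * (t ^ 2 / 8))) *
            ENNReal.ofReal (Real.exp (t ^ 2 / 8)) := by
          rw [expect_const_mul]
          gcongr
          refine expect_exp_le h0 h1 (fun b hb => ?_) ?_ t
          · rcases hX a c hc b hb with h | h <;> simp [h]
          · rw [← hp a c hc]
            exact prob_congr fun b _ => by rw [sub_eq_iff_eq_add, add_comm]
      _ = _ := by
          rw [← ENNReal.ofReal_mul (Real.exp_nonneg _), ← Real.exp_add]
          congr 2
          push_cast [List.length_cons]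
          ring

/-- Hoeffding's inequality for a counter that each round increases by one with probability `p`. -/
theorem failsWithin_inTurn_hoeffding (h0 : 0 ≤ p) (h1 : p ≤ 1)
    (hJ : ∀ a b, J b → (f a b).Sure J)
    (hX : ∀ a b, J b → (f a b).Sure fun b' => X b' = X b ∨ X b' = X b + 1)
    (hp : ∀ a b, J b → (f a b).prob (fun b' => X b' = X b + 1) = ENNReal.ofReal p)
    (l : List α) {c : β} (hc : J c) {δ : ℝ} (hδ : 0 ≤ δ) :
    (inTurn f l c).FailsWithin (fun b => |X b - X c - l.length * p| ≤ l.length * δ)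
      (ENNReal.ofReal (2 * Real.exp (-(2 * l.length * δ ^ 2)))) := by
  set N : ℝ := (l.length : ℝ)
  have hN : 0 ≤ N := Nat.cast_nonneg _
  -- Markov's inequality at t = ±4δ, where N t²/8 - N|t|δ attains its minimum -2Nδ². One sign serves
  -- each tail.
  have bound : ∀ t : ℝ, t ^ 2 = 16 * δ ^ 2 → (inTurn f l c).expect
      (fun b => ENNReal.ofReal (Real.exp (-(4 * N * δ ^ 2))) *
        ENNReal.ofReal (Real.exp (t * (X b - X c - N * p)))) ≤
        ENNReal.ofReal (Real.exp (-(2 * N * δ ^ 2))) := by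
    intro t ht
    rw [expect_const_mul]
    refine (mul_le_mul_right (expect_inTurn_exp_le h0 h1 hJ hX hp t l hc) _).trans (le_of_eq ?_)
    rw [← ENNReal.ofReal_mul (Real.exp_nonneg _), ← Real.exp_add, ht]
    congr 2
    ring
  rw [FailsWithin, two_mul, ENNReal.ofReal_add (Real.exp_nonneg _) (Real.exp_nonneg _)]
  refine le_trans ?_ (add_le_add (bound (4 * δ) (by ring)) (bound (-(4 * δ)) (by ring)))
  rw [← expect_add, prob]
  refine expect_mono fun b _ => ?_
  split_ifs with hb
  · exact zero_le
  · have one_le : ∀ x : ℝ, N * δ ≤ x → (1 : ℝ≥0∞) ≤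
        ENNReal.ofReal (Real.exp (-(4 * N * δ ^ 2))) * ENNReal.ofReal (Real.exp (4 * δ * x)) := by
      intro x hx
      rw [← ENNReal.ofReal_mul (Real.exp_nonneg _), ← Real.exp_add, ENNReal.one_le_ofReal,
        Real.one_le_exp_iff]
      nlinarith
    rw [not_le, lt_abs] at hb
    rcases hb with hb | hb
    · exact le_add_right (one_le _ hb.le)
    · refine le_add_left ((one_le _ hb.le).trans (le_of_eq ?_))
      congr 3
      ring

end Hoeffding

end RegProg

/-! ### Powers of the transition matrix are stochastic. -/

namespace WeightedGraph

variable {n : ℕ} (G : WeightedGraph n)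

theorem degree_nonneg (i : Fin n) : 0 ≤ G.degree i := Finset.sum_nonneg fun j _ => G.nonneg i j

theorem transition_nonneg (i j : Fin n) : 0 ≤ G.transition i j :=
  div_nonneg (G.nonneg i j) (G.degree_nonneg i)

theorem transition_pow_nonneg (s : ℕ) (i j : Fin n) : 0 ≤ (G.transition ^ s) i j := by
  induction s generalizing i j with
  | zero =>
    rw [pow_zero, Matrix.one_apply]
    split_ifs <;> simp
  | succ s ih =>
    rw [pow_succ, Matrix.mul_apply]
    exact Finset.sum_nonneg fun l _ => mul_nonneg (ih _ _) (G.transition_nonneg _ _)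

theorem sum_transition_pow (hd : ∀ i, 0 < G.degree i) (s : ℕ) (i : Fin n) :
    ∑ j, (G.transition ^ s) i j = 1 := by
  induction s generalizing i with
  | zero => simp [Matrix.one_apply]
  | succ s ih =>
    simp only [pow_succ', Matrix.mul_apply]
    rw [Finset.sum_comm]
    simp only [← Finset.mul_sum, ih, mul_one]
    simp only [transition, Matrix.of_apply, ← Finset.sum_div]
    exact div_self (hd i).ne'

theorem transition_pow_le_one (hd : ∀ i, 0 < G.degree i) (s : ℕ) (i j : Fin n) :
    (G.transition ^ s) i j ≤ 1 := by
  rw [← G.sum_transition_pow hd s i]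
  exact Finset.single_le_sum (f := fun j => (G.transition ^ s) i j)
    (fun l _ => G.transition_pow_nonneg s i l) (Finset.mem_univ j)

end WeightedGraph

/-! ### Reasoning about programs: frames, space, loops, and the laws of elementary loops. -/

namespace RegProg

open PMF
open scoped ENNReal

variable {n : ℕ} {ν ρ : Type} [Fintype ν] [Fintype ρ] [DecidableEq ν] [DecidableEq ρ]
  {I : Input n} {c c' : Config n ν ρ} {K : ℝ}

@[simp] theorem Config.setReal_real (c : Config n ν ρ) (y : ρ) (a : ℝ) :
    (c.setReal y a).real = Function.update c.real y a := rfl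

@[simp] theorem Config.setReal_vertex (c : Config n ν ρ) (y : ρ) (a : ℝ) :
    (c.setReal y a).vertex = c.vertex := rfl

@[simp] theorem Config.setVertex_real (c : Config n ν ρ) (x : ν) (i : Fin n) :
    (c.setVertex x i).real = c.real := rfl

@[simp] theorem Config.setVertex_vertex (c : Config n ν ρ) (x : ν) (i : Fin n) :
    (c.setVertex x i).vertex = Function.update c.vertex x i := rfl

/-- The real registers that a program may change. -/
def Prog.WritesReal : Prog ν ρ → ρ → Prop
  | .assign z _, y => y = z
  | .copy _ _, _ => False
  | .flip z, y => y = z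
  | .step _, _ => False
  | .skip, _ => False
  | .seq p q, y => p.WritesReal y ∨ q.WritesReal y
  | .cond _ p, y => p.WritesReal y
  | .loop z _ p, y => y = z ∨ p.WritesReal y
  | .forVertex _ p, y => p.WritesReal y

/-- The vertex registers that a program may change. -/
def Prog.WritesVertex : Prog ν ρ → ν → Prop
  | .assign _ _, _ => False
  | .copy z _, x => x = z
  | .flip _, _ => False
  | .step z, x => x = z
  | .skip, _ => False
  | .seq p q, x => p.WritesVertex x ∨ q.WritesVertex x
  | .cond _ p, x => p.WritesVertex x
  | .loop _ _ p, x => p.WritesVertex x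
  | .forVertex z p, x => x = z ∨ p.WritesVertex x

/-- Frame rule. The write set is syntactic, so later frame conditions are settled by simplification
alone; a loop counts as writing its own loop register. -/
theorem Prog.sure_real_eq (p : Prog ν ρ) {y : ρ} (hy : ¬ p.WritesReal y) (c : Config n ν ρ) :
    (p.exec I c).Sure fun c' => c'.real y = c.real y := by
  induction p generalizing c with
  | assign z e => simp_all [exec, sure_pure, WritesReal, Function.update_of_ne]
  | copy z e => simp [exec, sure_pure]
  | flip z => exact sure_map.2 fun _ _ => Function.update_of_ne hy _ _
  | step z => exact sure_map.2 fun _ _ => rfl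
  | skip => simp [exec, sure_pure]
  | seq p q ihp ihq =>
    simp only [WritesReal, not_or] at hy
    rw [exec]
    exact (ihp hy.1 c).bind fun c' h => (ihq hy.2 c').mono fun c'' h' => h'.trans h
  | cond t p ih =>
    rw [exec]
    split_ifs
    · exact ih hy c
    · simp [sure_pure]
  | loop z b p ih =>
    simp only [WritesReal, not_or] at hy
    rw [exec]
    refine sure_inTurn (J := fun c' : Config n ν ρ => c'.real y = c.real y) (fun m c' h => ?_) _ rfl
    refine (ih hy.2 _).mono fun c'' h' => h'.trans ?_
    simpa [Function.update_of_ne hy.1] using h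
  | forVertex z p ih =>
    rw [exec]
    refine sure_inTurn (J := fun c' : Config n ν ρ => c'.real y = c.real y) (fun m c' h => ?_) _ rfl
    exact (ih hy _).mono fun c'' h' => h'.trans h

theorem Prog.sure_vertex_eq (p : Prog ν ρ) {x : ν} (hx : ¬ p.WritesVertex x)
    (c : Config n ν ρ) : (p.exec I c).Sure fun c' => c'.vertex x = c.vertex x := by
  induction p generalizing c with
  | assign z e => simp [exec, sure_pure]
  | copy z e => simp_all [exec, sure_pure, WritesVertex, Function.update_of_ne]
  | flip z => exact sure_map.2 fun _ _ => rfl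
  | step z => exact sure_map.2 fun _ _ => Function.update_of_ne hx _ _
  | skip => simp [exec, sure_pure]
  | seq p q ihp ihq =>
    simp only [WritesVertex, not_or] at hx
    rw [exec]
    exact (ihp hx.1 c).bind fun c' h => (ihq hx.2 c').mono fun c'' h' => h'.trans h
  | cond t p ih =>
    rw [exec]
    split_ifs
    · exact ih hx c
    · simp [sure_pure]
  | loop z b p ih =>
    rw [exec]
    refine sure_inTurn (J := fun c' : Config n ν ρ => c'.vertex x = c.vertex x) (fun m c' h => ?_) _ rfl
    exact (ih hx _).mono fun c'' h' => h'.trans h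
  | forVertex z p ih =>
    simp only [WritesVertex, not_or] at hx
    rw [exec]
    refine sure_inTurn (J := fun c' : Config n ν ρ => c'.vertex x = c.vertex x) (fun m c' h => ?_) _ rfl
    refine (ih hx.2 _).mono fun c'' h' => h'.trans ?_
    simpa [Function.update_of_ne hx.1] using h

/-! ### Blocks -/

@[simp] theorem exec_block_nil : (block ([] : List (Prog ν ρ))).exec I c = PMF.pure c := by
  rw [block, List.foldr_nil, Prog.exec]

theorem exec_block_cons (p : Prog ν ρ) (l : List (Prog ν ρ)) :
    (block (p :: l)).exec I c = (p.exec I c).bind fun c' => (block l).exec I c' := by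
  rw [block, List.foldr_cons, Prog.exec, block]

theorem writesReal_block_nil (y : ρ) : (block ([] : List (Prog ν ρ))).WritesReal y ↔ False :=
  Iff.rfl

theorem writesReal_block_cons (p : Prog ν ρ) (l : List (Prog ν ρ)) (y : ρ) :
    (block (p :: l)).WritesReal y ↔ p.WritesReal y ∨ (block l).WritesReal y := Iff.rfl

theorem writesVertex_block_nil (x : ν) : (block ([] : List (Prog ν ρ))).WritesVertex x ↔ False :=
  Iff.rfl

theorem writesVertex_block_cons (p : Prog ν ρ) (l : List (Prog ν ρ)) (x : ν) :
    (block (p :: l)).WritesVertex x ↔ p.WritesVertex x ∨ (block l).WritesVertex x := Iff.rfl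

theorem exec_block_assign (y : ρ) (e : Arith ν ρ) (l : List (Prog ν ρ)) :
    (block (.assign y e :: l)).exec I c = (block l).exec I (c.setReal y (e.eval I c)) := by
  rw [exec_block_cons, Prog.exec, PMF.pure_bind]

theorem exec_block_copy (x x' : ν) (l : List (Prog ν ρ)) :
    (block (.copy x x' :: l)).exec I c = (block l).exec I (c.setVertex x (c.vertex x')) := by
  rw [exec_block_cons, Prog.exec, PMF.pure_bind]

theorem sure_block_cons {p : Prog ν ρ} {l : List (Prog ν ρ)} {G H : Config n ν ρ → Prop}
    (hp : (p.exec I c).Sure G) (hl : ∀ c', G c' → ((block l).exec I c').Sure H) :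
    ((block (p :: l)).exec I c).Sure H := by
  rw [exec_block_cons]
  exact hp.bind hl

/-! ### Space -/

/-- Every real register takes at most `K` bits, and the peak is what this allows. -/
structure Config.Within (c : Config n ν ρ) (K : ℝ) : Prop where
  bits_le : ∀ y, bits (c.real y) ≤ K
  peak_le : c.peak ≤ Fintype.card ν * bits n + Fintype.card ρ * K

theorem space_le {vertex : ν → Fin n} {real : ρ → ℝ} (h : ∀ y, bits (real y) ≤ K) :
    space vertex real ≤ Fintype.card ν * bits n + Fintype.card ρ * K := by
  rw [space, Finset.sum_const, nsmul_eq_mul, Finset.card_univ]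
  have := Finset.sum_le_sum fun y (_ : y ∈ Finset.univ) => h y
  rw [Finset.sum_const, nsmul_eq_mul, Finset.card_univ] at this
  linarith

theorem Config.Within.setReal (h : c.Within K) (y : ρ) {a : ℝ} (ha : bits a ≤ K) :
    (c.setReal y a).Within K := by
  have : ∀ z, bits (Function.update c.real y a z) ≤ K := by
    intro z
    rcases eq_or_ne z y with rfl | hz
    · simpa using ha
    · simpa [hz] using h.bits_le z
  exact ⟨this, max_le h.peak_le (space_le this)⟩

theorem Config.Within.setVertex (h : c.Within K) (x : ν) (i : Fin n) :
    (c.setVertex x i).Within K :=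
  ⟨h.bits_le, max_le h.peak_le (space_le h.bits_le)⟩

theorem Config.within_init [NeZero n] (hK : 1 ≤ K) : (Config.init n ν ρ).Within K := by
  have : ∀ y : ρ, bits ((Config.init n ν ρ).real y) ≤ K := by
    intro y
    simpa [Config.init, bits] using hK
  exact ⟨this, space_le (vertex := fun _ => 0) this⟩

/-! ### Rules for loops -/

theorem sure_loop {y : ρ} {b : Operand ν ρ} {p : Prog ν ρ} {m : ℕ} (hm : b.eval I c = m)
    {J : ℕ → Config n ν ρ → Prop}
    (h : ∀ j < m, ∀ c, J j c → (p.exec I (c.setReal y j)).Sure (J (j + 1))) (hc : J 0 c) :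
    ((Prog.loop y b p).exec I c).Sure (J m) := by
  rw [Prog.exec, hm, Nat.floor_natCast]
  exact sure_inTurn_range m h hc

theorem failsWithin_loop {y : ρ} {b : Operand ν ρ} {p : Prog ν ρ} {m : ℕ} (hm : b.eval I c = m)
    {J : ℕ → Config n ν ρ → Prop} {η : ℝ≥0∞}
    (h : ∀ j < m, ∀ c, J j c → (p.exec I (c.setReal y j)).FailsWithin (J (j + 1)) η)
    (hc : J 0 c) : ((Prog.loop y b p).exec I c).FailsWithin (J m) (m * η) := by
  rw [Prog.exec, hm, Nat.floor_natCast]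
  exact failsWithin_inTurn_range m h hc

theorem sure_forVertex {x : ν} {p : Prog ν ρ} {J : Finset (Fin n) → Config n ν ρ → Prop}
    (h : ∀ s i, i ∉ s → ∀ c, J s c → (p.exec I (c.setVertex x i)).Sure (J (insert i s)))
    (hc : J ∅ c) : ((Prog.forVertex x p).exec I c).Sure (J Finset.univ) := by
  rw [Prog.exec]
  exact sure_inTurn_finRange h hc

theorem failsWithin_forVertex {x : ν} {p : Prog ν ρ}
    {J : Finset (Fin n) → Config n ν ρ → Prop} {η : ℝ≥0∞}
    (h : ∀ s i, i ∉ s → ∀ c, J s c →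
      (p.exec I (c.setVertex x i)).FailsWithin (J (insert i s)) η)
    (hc : J ∅ c) : ((Prog.forVertex x p).exec I c).FailsWithin (J Finset.univ) (n * η) := by
  rw [Prog.exec]
  exact failsWithin_inTurn_finRange h hc

theorem Prog.sure_cond {t : Test ν ρ} {p : Prog ν ρ} {G : Config n ν ρ → Prop}
    (h : t.Holds I c → (p.exec I c).Sure G) (h' : ¬ t.Holds I c → G c) :
    ((Prog.cond t p).exec I c).Sure G := by
  rw [exec]
  split_ifs with ht
  · exact h ht
  · exact sure_pure.2 (h' ht)

theorem Prog.sure_flip {y : ρ} {G : Config n ν ρ → Prop}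
    (h0 : G (c.setReal y 0)) (h1 : G (c.setReal y 1)) : ((Prog.flip y).exec I c).Sure G := by
  rw [exec, sure_map]
  intro b _
  fin_cases b <;> simpa

theorem Prog.sure_step {x : ν} {G : Config n ν ρ → Prop} (h : ∀ i, G (c.setVertex x i)) :
    ((Prog.step x).exec I c).Sure G := by
  rw [exec, sure_map]
  exact fun i _ => h i

/-! ### The law of a sum of random bits and of a random walk -/

open Classical in
-- Pascal's rule: condition on the first bit.
theorem prob_sum_bits {y z w : ρ} {b : Operand ν ρ} (hyz : y ≠ z) (hzw : z ≠ w) {k : ℕ}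
    (hb : b.eval I c = k) (hz : c.real z = 0) (s : ℕ) :
    ((Prog.loop w b (block [.flip y, .assign z (.plus (.reg z) (.reg y))])).exec I c).prob
      (fun c' => c'.real z = s) = (k.choose s : ℝ≥0∞) / 2 ^ k := by
  rw [Prog.exec, hb, Nat.floor_natCast]
  -- After the first bit the counter need not be zero, so an arbitrary start o is carried along. The
  -- guard `o ≤ s` is essential: for o > s the truncated difference is 0 and the coefficient would
  -- be 1.
  have key : ∀ (l : List ℕ) (o : ℕ) (c : Config n ν ρ), c.real z = o →
      (inTurn (fun (m : ℕ) (c' : Config n ν ρ) =>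
        (block [.flip y, .assign z (.plus (.reg z) (.reg y))]).exec I
          (c'.setReal w (m : ℝ))) l c).prob (fun c' => c'.real z = s) =
        ((if o ≤ s then l.length.choose (s - o) else 0 : ℕ) : ℝ≥0∞) / 2 ^ l.length := by
    intro l
    induction l with
    | nil =>
      intro o c hc
      rw [inTurn, prob_pure, hc]
      rcases lt_trichotomy o s with h | rfl | h
      · obtain ⟨d, rfl⟩ := Nat.exists_eq_add_of_lt h
        rw [if_neg (by exact_mod_cast h.ne), if_pos h.le,
          show o + d + 1 - o = d + 1 by omega]
        simp
      · simp
      · rw [if_neg (by exact_mod_cast h.ne'), if_neg (by omega)]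
        simp
    | cons m l ih =>
      intro o c hc
      rw [inTurn, prob_bind, exec_block_cons, expect_bind, Prog.exec, expect_map, expect_fintype]
      simp only [exec_block_assign, exec_block_nil, expect_pure, Fin.sum_univ_two,
        PMF.uniformOfFintype_apply]
      rw [ih o _ (by simp [Arith.eval, Operand.eval, hyz.symm, hzw, hc]),
        ih (o + 1) _ (by simp [Arith.eval, Operand.eval, hyz.symm, hzw, hc])]
      have pascal : (if o ≤ s then (l.length + 1).choose (s - o) else 0) =
          (if o ≤ s then l.length.choose (s - o) else 0) +
          (if o + 1 ≤ s then l.length.choose (s - (o + 1)) else 0) := by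
        rcases lt_trichotomy o s with h | rfl | h
        · obtain ⟨d, rfl⟩ := Nat.exists_eq_add_of_lt h
          rw [if_pos h.le, if_pos h.le, if_pos (by omega), show o + d + 1 - o = d + 1 by omega,
            show o + d + 1 - (o + 1) = d by omega, Nat.choose_succ_succ, add_comm]
        · simp
        · rw [if_neg (by omega), if_neg (by omega), if_neg (by omega)]
      rw [List.length_cons, pascal, Nat.cast_add, pow_succ, Fintype.card_fin, div_eq_mul_inv,
        div_eq_mul_inv, div_eq_mul_inv, ENNReal.mul_inv (by simp) (by simp), Nat.cast_ofNat]
      ring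
  have := key (List.range k) 0 c (by simpa using hz)
  rw [List.length_range, if_pos (Nat.zero_le s), Nat.sub_zero] at this
  exact this

/-- Condition on the first step, in the form P^{s+1} = P P^s; the induction therefore runs over all
starting configurations. -/
theorem prob_walk {w : ρ} {b : Operand ν ρ} {x : ν} {s : ℕ} (hb : b.eval I c = s)
    (hd : ∀ i, 0 < I.graph.degree i) (i : Fin n) :
    ((Prog.loop w b (.step x)).exec I c).prob (fun c' => c'.vertex x = i) =
      ENNReal.ofReal ((I.graph.transition ^ s) (c.vertex x) i) := by
  classical
  rw [Prog.exec, hb, Nat.floor_natCast]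
  have hP := I.graph.transition_nonneg
  have hPs := I.graph.transition_pow_nonneg
  have key : ∀ (l : List ℕ) (c : Config n ν ρ),
      (inTurn (fun (m : ℕ) (c' : Config n ν ρ) => (Prog.step x).exec I (c'.setReal w (m : ℝ))) l c).prob
        (fun c' => c'.vertex x = i) =
        ENNReal.ofReal ((I.graph.transition ^ l.length) (c.vertex x) i) := by
    intro l
    induction l with
    | nil =>
      intro c
      rw [inTurn, prob_pure, List.length_nil, pow_zero, Matrix.one_apply]
      split_ifs <;> simp
    | cons m l ih =>
      intro c
      rw [inTurn, prob_bind, Prog.exec, expect_map, expect_fintype, List.length_cons, pow_succ',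
        Matrix.mul_apply, ENNReal.ofReal_sum_of_nonneg fun j _ => mul_nonneg (hP _ _) (hPs _ _ _)]
      refine Finset.sum_congr rfl fun j _ => ?_
      rw [ih, ENNReal.ofReal_mul (hP _ _)]
      simp [WeightedGraph.walkStep, hd]
  simpa using key (List.range s) c

end RegProg

/-! ### The three sampling estimates: their values for every outcome and their failure
probabilities. -/

namespace EstimateNorm

open PMF RegProg Operand Arith Test Prog
open scoped ENNReal

variable {n : ℕ} {I : Input n} {c : Config n VReg RReg} {K κ δ : ℝ} {r : ℕ}

/-- All numbers that occur in the estimation of one coordinate fit into `K` bits. -/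
structure Budget (K : ℝ) (k r : ℕ) (κ : ℝ) : Prop where
  steps : ∀ m : ℕ, m ≤ k + 1 → bits m ≤ K
  reps : ∀ m : ℕ, m ≤ r → bits m ≤ K
  fraction : ∀ A : ℕ, A ≤ r → bits (A / r) ≤ K
  product : ∀ A S : ℕ, A ≤ r → S ≤ r → bits (A / r * S) ≤ K
  mean : ∀ A S : ℕ, A ≤ r → S ≤ r → bits (A / r * S / r) ≤ K
  term : ∀ A S : ℕ, A ≤ r → S ≤ r → bits (A / r * S / r * κ) ≤ K
  entry : ∀ z : ℤ, |z| ≤ 2 * (k + 1) * r ^ 2 → bits (z / r ^ 2 * κ) ≤ K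
  square : ∀ z : ℤ, |z| ≤ 2 * (k + 1) * r ^ 2 → bits ((z / r ^ 2 * κ) * (z / r ^ 2 * κ)) ≤ K

/-- One round of `estimateBinomial`. -/
def binomialRound : Prog VReg RReg :=
  block [
    assign .ones (val (const 0)),
    loop .cnt inK (block [
      flip .bit,
      assign .ones (plus (reg .ones) (reg .bit))]),
    cond (same (reg .ones) (reg .s)) (assign .a (plus (reg .a) (const 1)))]

/-- One round of `estimateWalk`. -/
def walkRound (start : VReg) : Prog VReg RReg :=
  block [
    copy .pos start,
    loop .cnt (reg .s) (step .pos),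
    cond (sameVertex .pos .i) (assign .S (plus (reg .S) (const 1)))]

/-- A loop whose body increases the register `X` by zero or one. -/
theorem sure_counter {p : Prog VReg RReg} {X : RReg} {J : Config n VReg RReg → Prop}
    (h : ∀ m < r, ∀ c, J c → (∃ A : ℕ, A ≤ m ∧ c.real X = A) →
      (p.exec I (c.setReal .rep m)).Sure fun c' =>
        J c' ∧ (c'.real X = c.real X ∨ c'.real X = c.real X + 1))
    (hJ : J c) (hr : c.real .r = r) (hX : c.real X = 0) :
    ((loop .rep (reg .r) p).exec I c).Sure fun c' => J c' ∧ ∃ A : ℕ, A ≤ r ∧ c'.real X = A := by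
  refine sure_loop (m := r) (J := fun m (c' : Config n VReg RReg) => J c' ∧ ∃ A : ℕ, A ≤ m ∧ c'.real X = A)
    (show (reg RReg.r : Operand VReg RReg).eval I c = r from hr) ?_
    ⟨hJ, 0, le_rfl, by simpa using hX⟩
  rintro m hm c' ⟨hJ', A, hA, hXA⟩
  refine (h m hm c' hJ' ⟨A, hA, hXA⟩).mono ?_
  rintro c'' ⟨hJ'', h''⟩
  refine ⟨hJ'', ?_⟩
  rcases h'' with h'' | h''
  · exact ⟨A, by omega, by rw [h'', hXA]⟩
  · exact ⟨A + 1, by omega, by rw [h'', hXA]; push_cast; ring⟩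

/-- Hoeffding's inequality for a counter held in a register. The loop overwrites `rep` before every
round, so `X` must be another register and `J` must not depend on `rep`. -/
theorem failsWithin_counter {p : Prog VReg RReg} {X : RReg} (hX : X ≠ .rep)
    {J : Config n VReg RReg → Prop} {q : ℝ} (h0 : 0 ≤ q) (h1 : q ≤ 1)
    (hJr : ∀ c m, J c → J (c.setReal .rep m))
    (hJp : ∀ c, J c → (p.exec I c).Sure J)
    (hinc : ∀ c, J c → (p.exec I c).Sure fun c' =>
      c'.real X = c.real X ∨ c'.real X = c.real X + 1)
    (hp : ∀ c, J c → (p.exec I c).prob (fun c' => c'.real X = c.real X + 1) = ENNReal.ofReal q)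
    (hJ : J c) (hr : c.real .r = r) (h : c.real X = 0) (hδ : 0 ≤ δ) :
    ((loop .rep (reg .r) p).exec I c).FailsWithin (fun c' => |c'.real X - r * q| ≤ r * δ)
      (ENNReal.ofReal (2 * Real.exp (-(2 * r * δ ^ 2)))) := by
  rw [Prog.exec, show (reg RReg.r : Operand VReg RReg).eval I c = r from hr, Nat.floor_natCast]
  have := failsWithin_inTurn_hoeffding
    (f := fun (m : ℕ) (c' : Config n VReg RReg) => p.exec I (c'.setReal .rep (m : ℝ)))
    (J := J) (X := fun c' => c'.real X) h0 h1 (fun m c' hc' => hJp _ (hJr _ _ hc'))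
    (fun m c' hc' => by simpa [hX] using hinc _ (hJr c' m hc'))
    (fun m c' hc' => by simpa [hX] using hp _ (hJr c' m hc')) (List.range r) hJ hδ
  simpa [h] using this

theorem abs_div_sub_le {x y m e : ℝ} (hm : 0 < m) (h : |x - m * y| ≤ m * e) :
    |x / m - y| ≤ e := by
  rwa [← mul_le_mul_iff_right₀ hm, ← abs_of_pos hm, ← abs_mul, abs_of_pos hm, mul_sub,
    mul_div_cancel₀ _ hm.ne']

/-! ### Estimating a binomial coefficient -/

theorem sure_binomialRound_inc (c : Config n VReg RReg) :
    (binomialRound.exec I c).Sure fun c' =>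
      c'.real .a = c.real .a ∨ c'.real .a = c.real .a + 1 := by
  rw [binomialRound, exec_block_assign]
  refine sure_block_cons (G := fun c' => c'.real .a = c.real .a) ?_ fun c' h => ?_
  · refine (Prog.sure_real_eq _ (y := RReg.a) ?_ _).mono fun c' h => h.trans ?_
    · simp [WritesReal, writesReal_block_cons, writesReal_block_nil]
    · simp
  · refine sure_block_cons (G := fun c' => c'.real .a = c.real .a ∨ c'.real .a = c.real .a + 1)
      (sure_cond (fun _ => ?_) fun _ => Or.inl h) fun c'' h'' => ?_
    · rw [Prog.exec, sure_pure]
      simp [Arith.eval, Operand.eval, h]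
    · simpa [sure_pure] using h''

/-- The strict inequality `A < r` leaves room for the final increment, and the number of ones never
exceeds the number of bits drawn. -/
theorem sure_binomialRound (B : Budget K I.k r κ) (hW : c.Within K) {A : ℕ} (hA : A < r)
    (ha : c.real .a = A) : (binomialRound.exec I c).Sure fun c' => c'.Within K := by
  have h0 : bits 0 ≤ K := by simpa using B.steps 0 (by omega)
  have h1 : bits 1 ≤ K := by simpa using B.steps 1 (by omega)
  rw [binomialRound, exec_block_assign]
  refine sure_block_cons (G := fun c' => c'.real .a = A ∧ c'.Within K) ?_ fun c' h => ?_
  · refine Sure.and ((Prog.sure_real_eq _ (y := RReg.a) ?_ _).mono fun c' h => h.trans ?_) ?_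
    · simp [WritesReal, writesReal_block_cons, writesReal_block_nil]
    · simpa using ha
    · refine (sure_loop (m := I.k)
        (J := fun j c' => c'.Within K ∧ ∃ o : ℕ, o ≤ j ∧ c'.real .ones = o) rfl ?_ ?_).mono
        fun c' h => h.1
      · rintro j hj c' ⟨hW', o, ho, hones⟩
        have hW'' := hW'.setReal .cnt (B.steps j (by omega))
        refine sure_block_cons (G := fun c' => c'.Within K ∧ c'.real .ones = o ∧
          (c'.real .bit = 0 ∨ c'.real .bit = 1)) (sure_flip ?_ ?_) ?_
        · exact ⟨hW''.setReal _ h0, by simpa using hones, by simp⟩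
        · exact ⟨hW''.setReal _ h1, by simpa using hones, by simp⟩
        · rintro c'' ⟨h1, h2, h3⟩
          rw [exec_block_assign, exec_block_nil, sure_pure]
          have : ∃ o' : ℕ, o' ≤ j + 1 ∧
              (plus (reg .ones) (reg .bit) : Arith VReg RReg).eval I c'' = o' := by
            rcases h3 with h3 | h3
            · exact ⟨o, by omega, by simp [Arith.eval, Operand.eval, h2, h3]⟩
            · exact ⟨o + 1, by omega, by simp [Arith.eval, Operand.eval, h2, h3]⟩
          obtain ⟨o', ho', he⟩ := this
          rw [he]
          exact ⟨h1.setReal _ (B.steps o' (by omega)), o', ho', by simp⟩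
      · exact ⟨hW.setReal _ (by simpa [Arith.eval, Operand.eval] using h0), 0, le_rfl,
          by simp [Arith.eval, Operand.eval]⟩
  · refine sure_block_cons (G := fun c' => c'.Within K)
      (sure_cond (fun _ => ?_) fun _ => h.2) fun c'' h'' => ?_
    · rw [Prog.exec, sure_pure]
      refine h.2.setReal _ ?_
      simpa [Arith.eval, Operand.eval, h.1] using B.reps (A + 1) hA
    · rwa [exec_block_nil, sure_pure]

/-- The bit loop changes neither `a` nor `s`, so `a` grows exactly when the drawn bits add up to s.
-/
theorem prob_binomialRound {s : ℕ} (hs : c.real .s = s) :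
    (binomialRound.exec I c).prob (fun c' => c'.real .a = c.real .a + 1) =
      ENNReal.ofReal ((I.k.choose s : ℝ) / 2 ^ I.k) := by
  classical
  have key := prob_sum_bits (I := I) (c := c.setReal .ones 0) (y := RReg.bit) (z := RReg.ones)
    (w := RReg.cnt) (b := inK) (k := I.k) (by decide) (by decide) rfl (by simp) s
  rw [binomialRound, exec_block_assign, exec_block_cons, prob_bind]
  rw [ENNReal.ofReal_div_of_pos (by positivity), ENNReal.ofReal_natCast,
    ENNReal.ofReal_pow (by norm_num), ENNReal.ofReal_ofNat, ← key, prob]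
  have hval : (val (const 0) : Arith VReg RReg).eval I c = 0 := by
    simp [Arith.eval, Operand.eval]
  rw [hval]
  refine expect_congr fun c' hc' => ?_
  have ha : c'.real .a = c.real .a := by
    refine (Prog.sure_real_eq _ (y := RReg.a) ?_ _ c' hc').trans ?_
    · simp [WritesReal, writesReal_block_cons, writesReal_block_nil]
    · simp
  have hs' : c'.real .s = s := by
    refine (Prog.sure_real_eq _ (y := RReg.s) ?_ _ c' hc').trans ?_
    · simp [WritesReal, writesReal_block_cons, writesReal_block_nil]
    · simpa using hs
  rw [exec_block_cons, prob_bind, Prog.exec]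
  simp only [exec_block_nil, Test.Holds, Operand.eval, hs']
  split_ifs with h
  · rw [Prog.exec, expect_pure, prob_pure, if_pos]
    simp [Arith.eval, Operand.eval, ha]
  · rw [expect_pure, prob_pure, if_neg]
    simp [ha]

theorem sure_estimateBinomial (B : Budget K I.k r κ) (hW : c.Within K) (hr : c.real .r = r) :
    (estimateBinomial.exec I c).Sure fun c' =>
      c'.Within K ∧ ∃ A : ℕ, A ≤ r ∧ c'.real .a = A / r := by
  rw [estimateBinomial, exec_block_assign]
  refine sure_block_cons (G := fun c' => (c'.Within K ∧ c'.real .r = r) ∧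
    ∃ A : ℕ, A ≤ r ∧ c'.real .a = A) (sure_counter (p := binomialRound)
    (J := fun c' => c'.Within K ∧ c'.real .r = r) ?_ ?_ ?_ ?_) ?_
  · rintro m hm c' ⟨hW', hr'⟩ ⟨A, hA, ha⟩
    refine Sure.and (Sure.and (sure_binomialRound B (hW'.setReal _ (B.reps m hm.le))
      (A := A) (by omega) (by simpa using ha)) ?_) ?_
    · refine (Prog.sure_real_eq _ (y := RReg.r) ?_ _).mono fun c' h => h.trans ?_
      · simp [binomialRound, WritesReal, writesReal_block_cons, writesReal_block_nil]
      · simpa using hr'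
    · simpa using sure_binomialRound_inc (I := I) (c'.setReal .rep m)
  · exact ⟨hW.setReal _ (by simpa [Arith.eval, Operand.eval] using B.steps 0 (by omega)),
      by simpa using hr⟩
  · simpa using hr
  · simp [Arith.eval, Operand.eval]
  · rintro c' ⟨⟨hW', hr'⟩, A, hA, ha⟩
    rw [exec_block_assign, exec_block_nil, sure_pure]
    have he : (divide (reg .a) (reg .r) : Arith VReg RReg).eval I c' = A / r := by
      simp [Arith.eval, Operand.eval, ha, hr']
    rw [he]
    exact ⟨hW'.setReal _ (B.fraction A hA), A, hA, by simp⟩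

theorem failsWithin_estimateBinomial (hr : c.real .r = r) (hr0 : 0 < r) {s : ℕ}
    (hs : c.real .s = s) (hδ : 0 ≤ δ) :
    (estimateBinomial.exec I c).FailsWithin
      (fun c' => |c'.real .a - (I.k.choose s : ℝ) / 2 ^ I.k| ≤ δ)
      (ENNReal.ofReal (2 * Real.exp (-(2 * r * δ ^ 2)))) := by
  rw [estimateBinomial, exec_block_assign, exec_block_cons, ← add_zero (ENNReal.ofReal _)]
  have h1 : (I.k.choose s : ℝ) / 2 ^ I.k ≤ 1 := by
    rw [div_le_one (by positivity)]
    exact_mod_cast Nat.choose_le_two_pow _ _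
  have hrR : (0 : ℝ) < r := by exact_mod_cast hr0
  refine ((failsWithin_counter (p := binomialRound) (X := .a) (r := r) (by decide)
    (J := fun c' => c'.real .s = s) (by positivity) h1 (fun c m h => by simpa using h)
    (fun c h => ?_) (fun c _ => sure_binomialRound_inc c) (fun c h => prob_binomialRound h)
    (by simpa using hs) (by simpa using hr) (by simp [Arith.eval, Operand.eval]) hδ).and
    (Prog.sure_real_eq _ (y := RReg.r) ?_ _)).bind fun c' _ hc' => ?_
  · refine (Prog.sure_real_eq _ (y := RReg.s) ?_ _).mono fun c' h' => h'.trans h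
    simp [binomialRound, WritesReal, writesReal_block_cons, writesReal_block_nil]
  · simp [binomialRound, WritesReal, writesReal_block_cons, writesReal_block_nil]
  · have hr' : c'.real .r = r := hc'.2.trans (by simpa using hr)
    rw [failsWithin_zero_iff, exec_block_assign, exec_block_nil, sure_pure]
    have : (c'.setReal .a ((divide (reg .a) (reg .r) : Arith VReg RReg).eval I c')).real .a =
        c'.real .a / r := by simp [Arith.eval, Operand.eval, hr']
    rw [this]
    exact abs_div_sub_le hrR hc'.1

/-! ### Estimating the law of the walk -/

variable {start : VReg}

theorem sure_walkRound_inc (c : Config n VReg RReg) :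
    ((walkRound start).exec I c).Sure fun c' =>
      c'.real .S = c.real .S ∨ c'.real .S = c.real .S + 1 := by
  rw [walkRound, exec_block_copy]
  refine sure_block_cons (G := fun c' => c'.real .S = c.real .S) ?_ fun c' h => ?_
  · refine (Prog.sure_real_eq _ (y := RReg.S) ?_ _).mono fun c' h => h.trans ?_
    · simp [WritesReal]
    · simp
  · refine sure_block_cons (G := fun c' => c'.real .S = c.real .S ∨ c'.real .S = c.real .S + 1)
      (sure_cond (fun _ => ?_) fun _ => Or.inl h) fun c'' h'' => ?_
    · rw [Prog.exec, sure_pure]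
      simp [Arith.eval, Operand.eval, h]
    · simpa [sure_pure] using h''

theorem sure_walkRound (B : Budget K I.k r κ) (hW : c.Within K) {A : ℕ} (hA : A < r)
    (hS : c.real .S = A) {s : ℕ} (hs : c.real .s = s) (hsk : s ≤ I.k) :
    ((walkRound start).exec I c).Sure fun c' => c'.Within K := by
  rw [walkRound, exec_block_copy]
  refine sure_block_cons (G := fun c' => c'.real .S = A ∧ c'.Within K) ?_ fun c' h => ?_
  · refine Sure.and ((Prog.sure_real_eq _ (y := RReg.S) ?_ _).mono fun c' h => h.trans ?_) ?_
    · simp [WritesReal]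
    · simpa using hS
    · refine sure_loop (m := s) (J := fun _ (c' : Config n VReg RReg) => c'.Within K)
        (show (reg RReg.s : Operand VReg RReg).eval I (c.setVertex _ _) = s from hs) ?_ (hW.setVertex _ _)
      intro j hj c' hW'
      exact sure_step fun i => (hW'.setReal _ (B.steps j (by omega))).setVertex _ _
  · refine sure_block_cons (G := fun c' => c'.Within K)
      (sure_cond (fun _ => ?_) fun _ => h.2) fun c'' h'' => ?_
    · rw [Prog.exec, sure_pure]
      refine h.2.setReal _ ?_
      simpa [Arith.eval, Operand.eval, h.1] using B.reps (A + 1) hA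
    · simpa [sure_pure] using h''

theorem prob_walkRound (hd : ∀ i, 0 < I.graph.degree i) {s : ℕ} (hs : c.real .s = s) :
    ((walkRound start).exec I c).prob (fun c' => c'.real .S = c.real .S + 1) =
      ENNReal.ofReal ((I.graph.transition ^ s) (c.vertex start) (c.vertex .i)) := by
  classical
  have key := prob_walk (I := I) (c := c.setVertex .pos (c.vertex start)) (x := VReg.pos)
    (w := RReg.cnt) (b := reg .s) (s := s) hs hd (c.vertex .i)
  rw [Config.setVertex_vertex, Function.update_self] at key
  rw [walkRound, exec_block_copy, exec_block_cons, prob_bind, ← key, prob]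
  refine expect_congr fun c' hc' => ?_
  have hS : c'.real .S = c.real .S := by
    refine (Prog.sure_real_eq _ (y := RReg.S) ?_ _ c' hc').trans ?_
    · simp [WritesReal]
    · simp
  have hi : c'.vertex .i = c.vertex .i := by
    refine (Prog.sure_vertex_eq _ (x := VReg.i) ?_ _ c' hc').trans ?_
    · simp [WritesVertex]
    · simp
  rw [exec_block_cons, prob_bind, Prog.exec]
  simp only [exec_block_nil, Test.Holds, hi]
  split_ifs with h
  · rw [Prog.exec, expect_pure, prob_pure, if_pos]
    simp [Arith.eval, Operand.eval, hS]
  · rw [expect_pure, prob_pure, if_neg]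
    simp [hS]

theorem sure_estimateWalk (B : Budget K I.k r κ) (hW : c.Within K) (hr : c.real .r = r)
    {s : ℕ} (hs : c.real .s = s) (hsk : s ≤ I.k) {A : ℕ} (hA : A ≤ r)
    (ha : c.real .a = A / r) (hκ : c.real .coef = κ) :
    ((estimateWalk start).exec I c).Sure fun c' =>
      c'.Within K ∧ ∃ S : ℕ, S ≤ r ∧ c'.real .tmp = A / r * S / r * κ := by
  rw [estimateWalk, exec_block_assign]
  refine sure_block_cons (G := fun c' => (c'.Within K ∧ c'.real .r = r ∧ c'.real .s = s ∧
    c'.real .a = A / r ∧ c'.real .coef = κ) ∧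
    ∃ A : ℕ, A ≤ r ∧ c'.real .S = A) (sure_counter (p := walkRound start)
    (J := fun c' => c'.Within K ∧ c'.real .r = r ∧ c'.real .s = s ∧
      c'.real .a = A / r ∧ c'.real .coef = κ) ?_ ?_ ?_ ?_) ?_
  · rintro m hm c' ⟨hW', hr', hs', ha', hκ'⟩ ⟨S, hSm, hS⟩
    refine Sure.and (Sure.and (sure_walkRound B (hW'.setReal _ (B.reps m hm.le))
      (A := S) (by omega) (by simpa using hS) (by simpa using hs') hsk)
      (Sure.and ?_ (Sure.and ?_ (Sure.and ?_ ?_)))) ?_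
    · refine (Prog.sure_real_eq _ (y := RReg.r) ?_ _).mono fun c' h => h.trans ?_
      · simp [walkRound, WritesReal, writesReal_block_cons, writesReal_block_nil]
      · simpa using hr'
    · refine (Prog.sure_real_eq _ (y := RReg.s) ?_ _).mono fun c' h => h.trans ?_
      · simp [walkRound, WritesReal, writesReal_block_cons, writesReal_block_nil]
      · simpa using hs'
    · refine (Prog.sure_real_eq _ (y := RReg.a) ?_ _).mono fun c' h => h.trans ?_
      · simp [walkRound, WritesReal, writesReal_block_cons, writesReal_block_nil]
      · simpa using ha'
    · refine (Prog.sure_real_eq _ (y := RReg.coef) ?_ _).mono fun c' h => h.trans ?_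
      · simp [walkRound, WritesReal, writesReal_block_cons, writesReal_block_nil]
      · simpa using hκ'
    · simpa using sure_walkRound_inc (I := I) (start := start) (c'.setReal .rep m)
  · exact ⟨hW.setReal _ (by simpa [Arith.eval, Operand.eval] using B.steps 0 (by omega)),
      by simpa using hr, by simpa using hs, by simpa using ha, by simpa using hκ⟩
  · simpa using hr
  · simp [Arith.eval, Operand.eval]
  · rintro c' ⟨⟨hW', hr', hs', ha', hκ'⟩, S, hSr, hS⟩
    rw [exec_block_assign, exec_block_assign, exec_block_assign, exec_block_nil, sure_pure]
    simp only [Arith.eval, Operand.eval, Config.setReal_real, Function.update_self, ne_eq,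
      reduceCtorEq, not_false_eq_true, Function.update_of_ne, ha', hS, hr', hκ']
    exact ⟨((hW'.setReal _ (B.product A S hA hSr)).setReal _ (B.mean A S hA hSr)).setReal _
      (B.term A S hA hSr), S, hSr, rfl⟩

/-- The walk overwrites `pos`; with `start` a different register, every repetition begins at the
same vertex, and the success probability is the same in all rounds. -/
theorem failsWithin_estimateWalk (hd : ∀ i, 0 < I.graph.degree i) (hstart : start ≠ .pos)
    (hr : c.real .r = r) (hr0 : 0 < r) {s : ℕ}
    (hs : c.real .s = s) (hδ : 0 ≤ δ) (ha : 0 ≤ c.real .a) (hκ : 0 ≤ c.real .coef) :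
    ((estimateWalk start).exec I c).FailsWithin
      (fun c' => |c'.real .tmp -
        c.real .a * (I.graph.transition ^ s) (c.vertex start) (c.vertex .i) * c.real .coef| ≤
          c.real .a * δ * c.real .coef)
      (ENNReal.ofReal (2 * Real.exp (-(2 * r * δ ^ 2)))) := by
  set q := (I.graph.transition ^ s) (c.vertex start) (c.vertex .i) with hq
  have hrR : (0 : ℝ) < r := by exact_mod_cast hr0
  rw [estimateWalk, exec_block_assign, exec_block_cons, ← add_zero (ENNReal.ofReal _)]
  refine ((failsWithin_counter (p := walkRound start) (X := .S) (r := r) (q := q) (by decide)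
    (J := fun c' => c'.real .s = s ∧ c'.vertex start = c.vertex start ∧
      c'.vertex .i = c.vertex .i) (I.graph.transition_pow_nonneg _ _ _)
      (I.graph.transition_pow_le_one hd _ _ _) (fun c m h => by simpa using h)
    (fun c h => ?_) (fun c _ => sure_walkRound_inc c) (fun c h => ?_)
    (by simpa using hs) (by simpa using hr) (by simp [Arith.eval, Operand.eval]) hδ).and
    (Sure.and (Prog.sure_real_eq _ (y := RReg.r) ?_ _) (Sure.and
    (Prog.sure_real_eq _ (y := RReg.a) ?_ _)
    (Prog.sure_real_eq _ (y := RReg.coef) ?_ _)))).bind fun c' _ hc' => ?_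
  · refine Sure.and ?_ (Sure.and ?_ ?_)
    · refine (Prog.sure_real_eq _ (y := RReg.s) ?_ _).mono fun c' h' => h'.trans h.1
      simp [walkRound, WritesReal, writesReal_block_cons, writesReal_block_nil]
    · refine (Prog.sure_vertex_eq _ (x := start) ?_ _).mono fun c' h' => h'.trans h.2.1
      simp [walkRound, WritesVertex, writesVertex_block_cons, writesVertex_block_nil, hstart]
    · refine (Prog.sure_vertex_eq _ (x := VReg.i) ?_ _).mono fun c' h' => h'.trans h.2.2
      simp [walkRound, WritesVertex, writesVertex_block_cons, writesVertex_block_nil]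
  · rw [prob_walkRound hd h.1, h.2.1, h.2.2]
  · simp [walkRound, WritesReal, writesReal_block_cons, writesReal_block_nil]
  · simp [walkRound, WritesReal, writesReal_block_cons, writesReal_block_nil]
  · simp [walkRound, WritesReal, writesReal_block_cons, writesReal_block_nil]
  · obtain ⟨hS, hr', ha', hκ'⟩ := hc'
    replace hr' : c'.real .r = r := hr'.trans (by simpa using hr)
    replace ha' : c'.real .a = c.real .a := ha'.trans (by simp)
    replace hκ' : c'.real .coef = c.real .coef := hκ'.trans (by simp)
    rw [failsWithin_zero_iff, exec_block_assign, exec_block_assign, exec_block_assign,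
      exec_block_nil, sure_pure]
    simp only [Arith.eval, Operand.eval, Config.setReal_real, Function.update_self, ne_eq,
      reduceCtorEq, not_false_eq_true, Function.update_of_ne, ha', hr', hκ']
    have := abs_div_sub_le hrR hS
    calc _ = c.real .a * |c'.real .S / r - q| * c.real .coef := by
          rw [← abs_of_nonneg ha, ← abs_of_nonneg hκ, ← abs_mul, ← abs_mul, abs_of_nonneg ha,
            abs_of_nonneg hκ]
          congr 1
          ring
      _ ≤ _ := by gcongr

/-! ### One coordinate -/

/-- The invariant behind the space bound. The factors a = A/r and S/r share the denominator r, so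
each term is an integer over r² times κ. A round changes the integer by A S - A S' with both
products in [0, r²]; the allowance of 2r² per round also covers the intermediate value z + A S. -/
theorem sure_innerBody (B : Budget K I.k r κ) (hW : c.Within K) (hr : c.real .r = r)
    {s : ℕ} (hs : c.real .s = s) (hsk : s ≤ I.k) (hκ : c.real .coef = κ) {z : ℤ}
    (hz : |z| ≤ 2 * s * r ^ 2) (hQ : c.real .Q = z / r ^ 2 * κ) :
    (innerBody.exec I c).Sure fun c' => c'.Within K ∧
      ∃ z' : ℤ, |z'| ≤ 2 * (s + 1 : ℕ) * r ^ 2 ∧ c'.real .Q = z' / r ^ 2 * κ := by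
  have hrs : ∀ p : Prog VReg RReg, p = estimateBinomial ∨ p = estimateWalk .l1 ∨
      p = estimateWalk .l2 → ∀ c : Config n VReg RReg, (p.exec I c).Sure fun c' =>
        c'.real .r = c.real .r ∧ c'.real .s = c.real .s ∧ c'.real .coef = c.real .coef ∧
        c'.real .Q = c.real .Q := by
    rintro p (rfl | rfl | rfl) c
    all_goals
      refine Sure.and (Prog.sure_real_eq _ ?_ c) (Sure.and (Prog.sure_real_eq _ ?_ c)
        (Sure.and (Prog.sure_real_eq _ ?_ c) (Prog.sure_real_eq _ ?_ c)))
      all_goals simp [estimateBinomial, estimateWalk, WritesReal, writesReal_block_cons,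
        writesReal_block_nil]
  have hra : ∀ start : VReg, ∀ c : Config n VReg RReg, ((estimateWalk start).exec I c).Sure
      fun c' => c'.real .a = c.real .a := by
    intro start c
    refine Prog.sure_real_eq _ ?_ c
    simp [estimateWalk, WritesReal, writesReal_block_cons, writesReal_block_nil]
  have hrr : ∀ A S : ℕ, ∀ y : ℤ, (y / r ^ 2 * κ + A / r * S / r * κ : ℝ) =
      ((y + A * S : ℤ) : ℝ) / r ^ 2 * κ := by
    intro A S y
    push_cast
    ring
  have hrr' : ∀ A S : ℕ, ∀ y : ℤ, (y / r ^ 2 * κ - A / r * S / r * κ : ℝ) =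
      ((y - A * S : ℤ) : ℝ) / r ^ 2 * κ := by
    intro A S y
    push_cast
    ring
  have hAS : ∀ A S : ℕ, A ≤ r → S ≤ r → 0 ≤ (A * S : ℤ) ∧ (A * S : ℤ) ≤ r ^ 2 := by
    intro A S hA hS
    refine ⟨by positivity, ?_⟩
    rw [pow_two]
    exact_mod_cast Nat.mul_le_mul hA hS
  have hsk' : (2 * (s + 1 : ℕ) * r ^ 2 : ℤ) ≤ 2 * (I.k + 1) * r ^ 2 := by
    have : ((s + 1 : ℕ) : ℤ) ≤ I.k + 1 := by exact_mod_cast Nat.succ_le_succ hsk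
    gcongr
  rw [innerBody]
  refine sure_block_cons (Sure.and (hrs _ (by simp) c) (sure_estimateBinomial B hW hr)) ?_
  rintro c₁ ⟨⟨hr₁, hs₁, hκ₁, hQ₁⟩, hW₁, A, hA, ha₁⟩
  refine sure_block_cons (Sure.and (Sure.and (hra _ c₁) (hrs _ (by simp) c₁))
    (sure_estimateWalk B hW₁ (hr₁.trans hr) (hs₁.trans hs) hsk hA ha₁ (hκ₁.trans hκ))) ?_
  rintro c₂ ⟨⟨ha₂, hr₂, hs₂, hκ₂, hQ₂⟩, hW₂, S, hS, ht₂⟩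
  rw [exec_block_assign]
  have he : (plus (reg .Q) (reg .tmp) : Arith VReg RReg).eval I c₂ =
      ((z + A * S : ℤ) : ℝ) / r ^ 2 * κ := by
    rw [← hrr, ← ht₂, ← hQ, ← hQ₁, ← hQ₂]
    rfl
  have hz1 := hAS A S hA hS
  rw [he]
  rw [abs_le] at hz
  push_cast at hsk'
  have hW₃ := hW₂.setReal .Q (B.entry (z + A * S) (by rw [abs_le]; constructor <;> nlinarith))
  refine sure_block_cons (Sure.and (hrs _ (by simp) _)
    (sure_estimateWalk B (A := A) hW₃ (by simpa using hr₂.trans (hr₁.trans hr))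
    (by simpa using hs₂.trans (hs₁.trans hs)) hsk hA (by simpa using ha₂.trans ha₁)
    (by simpa using hκ₂.trans (hκ₁.trans hκ)))) ?_
  rintro c₄ ⟨⟨hr₄, hs₄, hκ₄, hQ₄⟩, hW₄, S', hS', ht₄⟩
  have hz2 := hAS A S' hA hS'
  have he : (minus (reg .Q) (reg .tmp) : Arith VReg RReg).eval I c₄ =
      ((z + A * S - A * S' : ℤ) : ℝ) / r ^ 2 * κ := by
    rw [← hrr', ← ht₄]
    simp only [Arith.eval, Operand.eval, hQ₄]
    simp
  rw [exec_block_assign, exec_block_nil, sure_pure, he]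
  have hz' : |z + A * S - A * S'| ≤ 2 * (s + 1 : ℕ) * r ^ 2 := by
    push_cast
    rw [abs_le]; constructor <;> nlinarith
  exact ⟨hW₄.setReal _ (B.entry _ (hz'.trans (by exact_mod_cast hsk'))), _, hz', by simp⟩

theorem failsWithin_innerBody (B : Budget K I.k r κ) (hW : c.Within K) (hr : c.real .r = r)
    (hr0 : 0 < r) (hd : ∀ i, 0 < I.graph.degree i)
    {s : ℕ} (hs : c.real .s = s) (hκ : c.real .coef = κ) (hκ0 : 0 ≤ κ) (hδ : 0 ≤ δ) :
    (innerBody.exec I c).FailsWithin (fun c' => |c'.real .Q - c.real .Q -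
      (I.k.choose s : ℝ) / 2 ^ I.k * ((I.graph.transition ^ s) (c.vertex .l1) (c.vertex .i) -
        (I.graph.transition ^ s) (c.vertex .l2) (c.vertex .i)) * κ| ≤ 4 * δ * κ)
      (3 * ENNReal.ofReal (2 * Real.exp (-(2 * r * δ ^ 2)))) := by
  set η := ENNReal.ofReal (2 * Real.exp (-(2 * r * δ ^ 2)))
  have hrs : ∀ p : Prog VReg RReg, p = estimateBinomial ∨ p = estimateWalk .l1 ∨
      p = estimateWalk .l2 → ∀ c : Config n VReg RReg, (p.exec I c).Sure fun c' =>
        c'.real .r = c.real .r ∧ c'.real .s = c.real .s ∧ c'.real .coef = c.real .coef ∧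
        c'.real .Q = c.real .Q ∧ c'.vertex .l1 = c.vertex .l1 ∧ c'.vertex .l2 = c.vertex .l2 ∧
        c'.vertex .i = c.vertex .i := by
    rintro p (rfl | rfl | rfl) c
    all_goals
      refine Sure.and (Prog.sure_real_eq _ ?_ c) (Sure.and (Prog.sure_real_eq _ ?_ c)
        (Sure.and (Prog.sure_real_eq _ ?_ c) (Sure.and (Prog.sure_real_eq _ ?_ c)
        (Sure.and (Prog.sure_vertex_eq _ ?_ c) (Sure.and (Prog.sure_vertex_eq _ ?_ c)
        (Prog.sure_vertex_eq _ ?_ c))))))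
      all_goals simp [estimateBinomial, estimateWalk, WritesReal, writesReal_block_cons,
        writesReal_block_nil, WritesVertex, writesVertex_block_cons, writesVertex_block_nil]
  have hra : ∀ start : VReg, ∀ c : Config n VReg RReg, ((estimateWalk start).exec I c).Sure
      fun c' => c'.real .a = c.real .a := by
    intro start c
    refine Prog.sure_real_eq _ ?_ c
    simp [estimateWalk, WritesReal, writesReal_block_cons, writesReal_block_nil]
  rw [innerBody, exec_block_cons, show 3 * η = η + (η + (η + 0)) by ring]
  -- The form a = A/r with A ≤ r is kept because it gives 0 ≤ a ≤ 1; this is why a space hypothesis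
  -- enters an accuracy statement.
  refine (((failsWithin_estimateBinomial hr hr0 hs hδ).and (hrs _ (by simp) c)).and
    (sure_estimateBinomial B hW hr)).bind ?_
  rintro c₁ - ⟨⟨hb, hr₁, hs₁, hκ₁, hQ₁, hl₁, hm₁, hi₁⟩, -, A, hA, ha₁⟩
  have hrR : (0 : ℝ) < r := by exact_mod_cast hr0
  have ha0 : 0 ≤ c₁.real .a := by rw [ha₁]; positivity
  have ha1 : c₁.real .a ≤ 1 := by
    rw [ha₁, div_le_one hrR]
    exact_mod_cast hA
  rw [exec_block_cons]
  refine (((failsWithin_estimateWalk hd (by decide) (hr₁.trans hr) hr0 (hs₁.trans hs) hδ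
    ha0 (by rwa [hκ₁, hκ])).and (hrs _ (by simp) c₁)).and (hra _ c₁)).bind ?_
  rintro c₂ - ⟨⟨ht₂, hr₂, hs₂, hκ₂, hQ₂, hl₂, hm₂, hi₂⟩, ha₂⟩
  rw [exec_block_assign, exec_block_cons]
  refine ((failsWithin_estimateWalk (s := s) (r := r) hd (by decide)
    (by simpa using hr₂.trans (hr₁.trans hr)) hr0
    (by simpa using hs₂.trans (hs₁.trans hs)) hδ (by simpa [ha₂] using ha0)
    (by simpa [hκ₂, hκ₁, hκ] using hκ0)).and (hrs _ (by simp) _)).bind ?_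
  rintro c₄ - ⟨ht₄, -, -, -, hQ₄, -, -, -⟩
  rw [exec_block_assign, exec_block_nil, failsWithin_zero_iff, sure_pure]
  simp only [Arith.eval, Operand.eval, Config.setReal_real, Function.update_self, ne_eq,
    reduceCtorEq, not_false_eq_true, Function.update_of_ne, Config.setReal_vertex, hQ₄, hQ₂, hQ₁,
    hl₁, hm₁, hm₂, hi₁, hi₂, ha₂, hκ₁, hκ₂, hκ] at ht₂ ht₄ ⊢
  set a := c₁.real .a
  set b := (I.k.choose s : ℝ) / 2 ^ I.k
  set p₁ := (I.graph.transition ^ s) (c.vertex .l1) (c.vertex .i) with hp₁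
  set p₂ := (I.graph.transition ^ s) (c.vertex .l2) (c.vertex .i) with hp₂
  have h1 : 0 ≤ p₁ := I.graph.transition_pow_nonneg _ _ _
  have h1' : p₁ ≤ 1 := I.graph.transition_pow_le_one hd _ _ _
  have h2 : 0 ≤ p₂ := I.graph.transition_pow_nonneg _ _ _
  have h2' : p₂ ≤ 1 := I.graph.transition_pow_le_one hd _ _ _
  -- Both walks are weighted by the same estimate a, so its error is multiplied by p₁ - p₂, of
  -- absolute value at most 1, and is paid only once.
  have e1 : |(a - b) * (p₁ - p₂) * κ| ≤ δ * 1 * κ := by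
    rw [abs_mul, abs_mul, abs_of_nonneg hκ0]
    gcongr
    rw [abs_le]; constructor <;> linarith
  have e2 : a * δ * κ ≤ 1 * δ * κ := by gcongr
  calc _ = |(c₂.real .tmp - a * p₁ * κ) - (c₄.real .tmp - a * p₂ * κ) +
        (a - b) * (p₁ - p₂) * κ| := by congr 1; ring
    _ ≤ |c₂.real .tmp - a * p₁ * κ| + |c₄.real .tmp - a * p₂ * κ| +
        |(a - b) * (p₁ - p₂) * κ| :=
      (abs_add_le _ _).trans (add_le_add_left (abs_sub _ _) _)
    -- The three errors add up to 3δκ; the constant 4 is slack.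
    _ ≤ 4 * δ * κ := by
      have : 0 ≤ δ * κ := mul_nonneg hδ hκ0
      linarith

end EstimateNorm

/-! ### The target coordinates and the degree ratio. -/

namespace WeightedGraph

variable {n : ℕ} (G : WeightedGraph n)

/-- The factor `√(d_a d_b / ((d_a + d_b) d_i))`, in the form in which the procedure computes it. -/
noncomputable def coefficient (a b i : Fin n) : ℝ :=
  √(G.degree a / G.degree i / (G.degree a / G.degree b + 1))

/-- The `i`-th coordinate of `M_G^k v`, as a combination of walk probabilities. -/
noncomputable def walkCoordinate (k : ℕ) (a b i : Fin n) : ℝ :=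
  ∑ s ∈ Finset.range (k + 1), (k.choose s : ℝ) / 2 ^ k *
    ((G.transition ^ s) a i - (G.transition ^ s) b i) * G.coefficient a b i

theorem div_degree_le_degreeRatio (hd : ∀ i, 0 < G.degree i) (x y : Fin n) :
    G.degree x / G.degree y ≤ G.degreeRatio := by
  have : Nonempty (Fin n) := ⟨x⟩
  obtain ⟨z, hz⟩ := exists_eq_ciInf_of_finite (f := G.degree)
  have h1 : G.degree x ≤ ⨆ i, G.degree i := le_ciSup (Set.finite_range _).bddAbove x
  have h2 : ⨅ i, G.degree i ≤ G.degree y := ciInf_le (Set.finite_range _).bddBelow y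
  have h3 : 0 < ⨅ i, G.degree i := hz ▸ hd z
  exact div_le_div₀ ((hd x).le.trans h1) h1 h3 h2

theorem exists_degreeRatio_eq [NeZero n] :
    ∃ x y, G.degreeRatio = G.degree x / G.degree y := by
  obtain ⟨x, hx⟩ := exists_eq_ciSup_of_finite (f := G.degree)
  obtain ⟨y, hy⟩ := exists_eq_ciInf_of_finite (f := G.degree)
  exact ⟨x, y, by rw [degreeRatio, hx, hy]⟩

theorem one_le_degreeRatio [NeZero n] (hd : ∀ i, 0 < G.degree i) : 1 ≤ G.degreeRatio := by
  have := G.div_degree_le_degreeRatio hd 0 0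
  rwa [div_self (hd 0).ne'] at this

end WeightedGraph

/-! ### The treatment of one vertex, and the computation of the parameters. -/

namespace EstimateNorm

open PMF RegProg Operand Arith Test Prog
open scoped ENNReal

variable {n : ℕ} {I : Input n} {c : Config n VReg RReg} {K κ δ : ℝ} {r : ℕ}

/-- The degree expressions computed by the procedure fit into `K` bits. -/
structure DegreeBudget (G : WeightedGraph n) (K : ℝ) : Prop where
  ratio : ∀ x y, bits (G.degree x / G.degree y) ≤ K
  ratio_add_one : ∀ x y, bits (G.degree x / G.degree y + 1) ≤ K
  quotient : ∀ a b i, bits (G.degree a / G.degree i / (G.degree a / G.degree b + 1)) ≤ K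
  coefficient : ∀ a b i, bits (G.coefficient a b i) ≤ K

/-- The assignments before the loop over s are deterministic and collapse to a single configuration,
which the space argument and the accuracy argument share. -/
theorem exists_exec_outerBody (D : DegreeBudget I.graph K) (B : Budget K I.k r κ)
    (hW : c.Within K) {a b i : Fin n}
    (ha : c.vertex .l1 = a) (hb : c.vertex .l2 = b) (hi : c.vertex .i = i) :
    ∃ c₁ : Config n VReg RReg, outerBody.exec I c = (block [
        loop .s (reg .bound) innerBody,
        assign .tmp (times (reg .Q) (reg .Q)),
        assign .R (plus (reg .R) (reg .tmp))]).exec I c₁ ∧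
      c₁.Within K ∧ c₁.vertex = c.vertex ∧ c₁.real .Q = 0 ∧ c₁.real .r = c.real .r ∧
      c₁.real .R = c.real .R ∧ c₁.real .coef = I.graph.coefficient a b i ∧
      c₁.real .bound = (I.k + 1 : ℕ) := by
  rw [outerBody, exec_block_assign, exec_block_cons, computeCoef]
  simp only [exec_block_assign, exec_block_nil, PMF.pure_bind]
  refine ⟨_, rfl, ?_⟩
  · simp only [Arith.eval, Operand.eval, Config.setReal_real, Config.setReal_vertex,
      Function.update_self, ne_eq, reduceCtorEq, not_false_eq_true, Function.update_of_ne,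
      ha, hb, hi, Nat.cast_one, Nat.cast_zero, true_and]
    refine ⟨?_, rfl, by push_cast; rfl⟩
    refine ((((((hW.setReal _ ?_).setReal _ ?_).setReal _ ?_).setReal _ ?_).setReal _ ?_).setReal
      _ ?_).setReal _ ?_
    · simpa using B.steps 0 (by omega)
    · exact D.ratio _ _
    · exact D.ratio _ _
    · simpa using D.ratio_add_one _ _
    · simpa using D.quotient _ _ _
    · exact D.coefficient a b i
    · simpa using B.steps (I.k + 1) le_rfl

theorem sure_innerBody_frame (c : Config n VReg RReg) : (innerBody.exec I c).Sure fun c' =>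
    c'.real .r = c.real .r ∧ c'.real .R = c.real .R ∧ c'.real .coef = c.real .coef ∧
      c'.vertex .l1 = c.vertex .l1 ∧ c'.vertex .l2 = c.vertex .l2 ∧
      c'.vertex .i = c.vertex .i := by
  refine Sure.and (Prog.sure_real_eq _ ?_ c) (Sure.and (Prog.sure_real_eq _ ?_ c)
    (Sure.and (Prog.sure_real_eq _ ?_ c) (Sure.and (Prog.sure_vertex_eq _ ?_ c)
    (Sure.and (Prog.sure_vertex_eq _ ?_ c) (Prog.sure_vertex_eq _ ?_ c)))))
  all_goals simp [innerBody, estimateBinomial, estimateWalk, WritesReal, writesReal_block_cons,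
    writesReal_block_nil, WritesVertex, writesVertex_block_cons, writesVertex_block_nil]

theorem sure_loop_innerBody (B : Budget K I.k r κ) (hW : c.Within K) (hr : c.real .r = r)
    (hQ : c.real .Q = 0) (hκ : c.real .coef = κ) (hbd : c.real .bound = (I.k + 1 : ℕ)) :
    ((loop .s (reg .bound) innerBody).exec I c).Sure fun c' => c'.Within K ∧
      c'.real .R = c.real .R ∧
      ∃ z : ℤ, |z| ≤ 2 * (I.k + 1) * r ^ 2 ∧ c'.real .Q = z / r ^ 2 * κ := by
  refine (sure_loop (m := I.k + 1) (J := fun s (c' : Config n VReg RReg) => (c'.real .r = r ∧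
    c'.real .R = c.real .R ∧ c'.real .coef = κ) ∧ c'.Within K ∧
    ∃ z : ℤ, |z| ≤ 2 * s * r ^ 2 ∧ c'.real .Q = z / r ^ 2 * κ)
    (show (reg RReg.bound : Operand VReg RReg).eval I c = _ from hbd) ?_ ?_).mono ?_
  · rintro s hs c' ⟨⟨hr', hR', hκ'⟩, hW', z, hz, hQ'⟩
    refine Sure.and ((sure_innerBody_frame _).mono ?_) (sure_innerBody (z := z) B
      (hW'.setReal _ (B.steps s (by omega))) (by simpa using hr') (s := s) (by simp) (by omega)
      (by simpa using hκ') hz (by simpa using hQ'))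
    rintro c'' ⟨h1, h2, h3, -⟩
    exact ⟨h1.trans (by simpa using hr'), h2.trans (by simpa using hR'),
      h3.trans (by simpa using hκ')⟩
  · exact ⟨⟨hr, rfl, hκ⟩, hW, 0, by simp, by simpa using hQ⟩
  · rintro c' ⟨⟨-, hR', -⟩, hW', z, hz, hQ'⟩
    exact ⟨hW', hR', z, by exact_mod_cast hz, hQ'⟩

theorem sure_outerBody (D : DegreeBudget I.graph K) (hW : c.Within K)
    {a b i : Fin n} (B : Budget K I.k r (I.graph.coefficient a b i)) (hr : c.real .r = r)
    (ha : c.vertex .l1 = a) (hb : c.vertex .l2 = b) (hi : c.vertex .i = i)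
    (hR : ∀ z : ℤ, |z| ≤ 2 * (I.k + 1) * r ^ 2 →
      bits (c.real .R + (z / r ^ 2 * I.graph.coefficient a b i) *
        (z / r ^ 2 * I.graph.coefficient a b i)) ≤ K) :
    (outerBody.exec I c).Sure fun c' => c'.Within K ∧ ∃ z : ℤ, |z| ≤ 2 * (I.k + 1) * r ^ 2 ∧
      c'.real .R = c.real .R + (z / r ^ 2 * I.graph.coefficient a b i) *
        (z / r ^ 2 * I.graph.coefficient a b i) := by
  obtain ⟨c₁, he, hW₁, hv, hQ, hr₁, hR₁, hκ, hbd⟩ := exists_exec_outerBody D B hW ha hb hi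
  rw [he]
  refine sure_block_cons (sure_loop_innerBody B hW₁ (hr₁.trans hr) hQ hκ hbd) ?_
  rintro c' ⟨hW', hR', z, hz, hQ'⟩
  rw [exec_block_assign, exec_block_assign, exec_block_nil, sure_pure]
  simp only [Arith.eval, Operand.eval, Config.setReal_real,
    Function.update_self, ne_eq, reduceCtorEq, not_false_eq_true, Function.update_of_ne,
    hQ', hR', hR₁]
  exact ⟨(hW'.setReal _ (B.square z hz)).setReal _ (hR z hz), z, hz, rfl⟩

/-- The error of the partial sum grows by 4δκ per round. The invariant also carries the integer form
of `Q` and the space bound, without which the next round could not be analysed. -/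
theorem failsWithin_outerBody (D : DegreeBudget I.graph K) (hW : c.Within K)
    {a b i : Fin n} (B : Budget K I.k r (I.graph.coefficient a b i)) (hr : c.real .r = r)
    (ha : c.vertex .l1 = a) (hb : c.vertex .l2 = b) (hi : c.vertex .i = i)
    (hr0 : 0 < r) (hd : ∀ i, 0 < I.graph.degree i) (hδ : 0 ≤ δ) :
    (outerBody.exec I c).FailsWithin (fun c' =>
      ∃ q : ℝ, |q - I.graph.walkCoordinate I.k a b i| ≤
        (I.k + 1) * (4 * δ * I.graph.coefficient a b i) ∧ c'.real .R = c.real .R + q * q)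
      ((I.k + 1 : ℕ) * (3 * ENNReal.ofReal (2 * Real.exp (-(2 * r * δ ^ 2))))) := by
  obtain ⟨c₁, he, hW₁, hv, hQ, hr₁, hR₁, hκ, hbd⟩ := exists_exec_outerBody D B hW ha hb hi
  set κ := I.graph.coefficient a b i
  have hκ0 : 0 ≤ κ := Real.sqrt_nonneg _
  rw [he, exec_block_cons, ← add_zero (((I.k + 1 : ℕ) : ℝ≥0∞) * _)]
  refine (failsWithin_loop (m := I.k + 1) (J := fun m (c' : Config n VReg RReg) => |c'.real .Q -
    ∑ s ∈ Finset.range m, (I.k.choose s : ℝ) / 2 ^ I.k *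
      ((I.graph.transition ^ s) a i - (I.graph.transition ^ s) b i) * κ| ≤ m * (4 * δ * κ) ∧
    (c'.real .r = r ∧ c'.real .R = c.real .R ∧ c'.real .coef = κ ∧ c'.vertex .l1 = a ∧
    c'.vertex .l2 = b ∧ c'.vertex .i = i) ∧ c'.Within K ∧
    ∃ z : ℤ, |z| ≤ 2 * m * r ^ 2 ∧ c'.real .Q = z / r ^ 2 * κ)
    (show (reg RReg.bound : Operand VReg RReg).eval I c₁ = _ from hbd) ?_ ?_).bind ?_
  · rintro s hs c' ⟨hacc, ⟨hr', hR', hκ', ha', hb', hi'⟩, hW', z, hz, hQ'⟩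
    have hWs := hW'.setReal .s (B.steps s (by omega))
    refine ((failsWithin_innerBody B hWs (by simpa using hr') hr0 hd (s := s) (by simp)
      (by simpa using hκ') hκ0 hδ).and (Sure.and (sure_innerBody_frame _)
      (sure_innerBody (z := z) B hWs (by simpa using hr') (s := s) (by simp) (by omega)
      (by simpa using hκ') hz (by simpa using hQ')))).mono ?_ le_rfl
    rintro c'' - ⟨hinc, ⟨h1, h2, h3, h4, h5, h6⟩, h7⟩
    refine ⟨?_, ⟨h1.trans (by simpa using hr'), h2.trans (by simpa using hR'),
      h3.trans (by simpa using hκ'), h4.trans ha', h5.trans hb', h6.trans hi'⟩, h7⟩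
    simp only [Config.setReal_real, Config.setReal_vertex, ne_eq, reduceCtorEq,
      not_false_eq_true, Function.update_of_ne, ha', hb', hi'] at hinc
    rw [Finset.sum_range_succ]
    set x := (I.k.choose s : ℝ) / 2 ^ I.k *
      ((I.graph.transition ^ s) a i - (I.graph.transition ^ s) b i) * κ
    set y := ∑ s ∈ Finset.range s, (I.k.choose s : ℝ) / 2 ^ I.k *
      ((I.graph.transition ^ s) a i - (I.graph.transition ^ s) b i) * κ
    calc |c''.real .Q - (y + x)| = |(c''.real .Q - c'.real .Q - x) + (c'.real .Q - y)| := by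
          congr 1; ring
      _ ≤ 4 * δ * κ + s * (4 * δ * κ) := (abs_add_le _ _).trans (add_le_add hinc hacc)
      _ = _ := by push_cast; ring
  · exact ⟨by simp [hQ], ⟨hr₁.trans hr, hR₁, hκ, by rw [hv, ha], by rw [hv, hb], by rw [hv, hi]⟩,
      hW₁, 0, by simp, by simpa using hQ⟩
  · rintro c' - ⟨hacc, ⟨-, hR', -⟩, -⟩
    rw [failsWithin_zero_iff, exec_block_assign, exec_block_assign, exec_block_nil, sure_pure]
    refine ⟨c'.real .Q, by simpa [WeightedGraph.walkCoordinate] using hacc, ?_⟩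
    simp [Arith.eval, Operand.eval, hR']

/-! ### The deterministic part -/

theorem sure_computeRatio [NeZero n] (hd : ∀ i, 0 < I.graph.degree i)
    (D : DegreeBudget I.graph K) (hW : c.Within K) (h0 : c.real .dd = 0) :
    (computeRatio.exec I c).Sure fun c' => c'.Within K ∧ c'.real .dd = I.graph.degreeRatio := by
  set d := I.graph.degree with hdef
  -- The value 0 is admitted besides ratios of degrees because it is the initial content of `dd`; at
  -- the end it is excluded since 𝔡 ≥ 1.
  refine (sure_forVertex (J := fun s (c : Config n VReg RReg) => c.Within K ∧
    (c.real .dd = 0 ∨ ∃ x y, c.real .dd = d x / d y) ∧ ∀ x ∈ s, ∀ y, d x / d y ≤ c.real .dd)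
    ?_ ⟨hW, Or.inl h0, by simp⟩).mono ?_
  · rintro s x - c₁ ⟨hW₁, hor₁, hs₁⟩
    refine (sure_forVertex (J := fun t (c : Config n VReg RReg) => c.vertex .x = x ∧ c.Within K ∧
      (c.real .dd = 0 ∨ ∃ x y, c.real .dd = d x / d y) ∧
      (∀ x ∈ s, ∀ y, d x / d y ≤ c.real .dd) ∧ ∀ y ∈ t, d x / d y ≤ c.real .dd)
      ?_ ⟨by simp, hW₁.setVertex _ _, hor₁, hs₁, by simp⟩).mono ?_
    · rintro t y - c₂ ⟨hx₂, hW₂, hor₂, hs₂, ht₂⟩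
      rw [exec_block_assign]
      have he : (divide (deg .x) (deg .y) : Arith VReg RReg).eval I (c₂.setVertex .y y) =
          d x / d y := by
        simp [Arith.eval, Operand.eval, hx₂, hdef]
      rw [he]
      have hW₃ := (hW₂.setVertex .y y).setReal .tmp (D.ratio x y)
      refine sure_block_cons (sure_cond (fun hlt => ?_) fun hlt => ?_)
        fun c' h' => by rwa [exec_block_nil, sure_pure]
      · rw [Prog.exec, sure_pure]
        simp only [Test.Holds, Operand.eval, Config.setReal_real, Config.setVertex_real,
          Function.update_self, ne_eq, reduceCtorEq, not_false_eq_true,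
          Function.update_of_ne] at hlt
        simp only [Arith.eval, Operand.eval, Config.setReal_real, Config.setReal_vertex,
          Config.setVertex_vertex, Function.update_self, ne_eq, reduceCtorEq, not_false_eq_true,
          Function.update_of_ne, hx₂, true_and]
        refine ⟨hW₃.setReal _ (D.ratio x y), Or.inr ⟨x, y, rfl⟩,
          fun x' hx' y' => (hs₂ x' hx' y').trans hlt.le, fun y' hy' => ?_⟩
        rcases Finset.mem_insert.1 hy' with rfl | hy'
        · exact le_rfl
        · exact (ht₂ y' hy').trans hlt.le
      · simp only [Test.Holds, Operand.eval, Config.setReal_real, Config.setVertex_real,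
          Function.update_self, ne_eq, reduceCtorEq, not_false_eq_true,
          Function.update_of_ne, not_lt] at hlt
        simp only [Config.setReal_real, Config.setReal_vertex,
          Config.setVertex_vertex, Config.setVertex_real, ne_eq, reduceCtorEq, not_false_eq_true,
          Function.update_of_ne, hx₂, true_and]
        refine ⟨hW₃, hor₂, hs₂, fun y' hy' => ?_⟩
        rcases Finset.mem_insert.1 hy' with rfl | hy'
        · exact hlt
        · exact ht₂ y' hy'
    · rintro c₂ ⟨-, hW₂, hor₂, hs₂, ht₂⟩
      refine ⟨hW₂, hor₂, fun x' hx' y => ?_⟩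
      rcases Finset.mem_insert.1 hx' with rfl | hx'
      · exact ht₂ y (Finset.mem_univ _)
      · exact hs₂ x' hx' y
  · rintro c₁ ⟨hW₁, hor₁, hs₁⟩
    refine ⟨hW₁, ?_⟩
    have hge : I.graph.degreeRatio ≤ c₁.real .dd := by
      obtain ⟨x, y, h⟩ := I.graph.exists_degreeRatio_eq
      rw [h]
      exact hs₁ x (Finset.mem_univ _) y
    have := I.graph.one_le_degreeRatio hd
    rcases hor₁ with h | ⟨x, y, h⟩
    · linarith
    · exact le_antisymm (h ▸ I.graph.div_degree_le_degreeRatio hd x y) hge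

/-- The numbers that occur in the computation of `δ` and `r` fit into `K` bits. -/
structure ParameterBudget (K : ℝ) (n k : ℕ) (ε γ 𝔡 : ℝ) : Prop where
  eps_sq : bits (ε * ε) ≤ K
  root_two : bits √2 ≤ K
  d₁ : bits (ε * ε * √2) ≤ K
  d₂ : bits (ε * ε * √2 / 54) ≤ K
  succ : bits (k + 1) ≤ K
  d₃ : bits (ε * ε * √2 / 54 / (k + 1)) ≤ K
  d₄ : bits (ε * ε * √2 / 54 / (k + 1) / n) ≤ K
  d₅ : bits (ε * ε * √2 / 54 / (k + 1) / n / 𝔡) ≤ K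
  succ_mul : bits ((k + 1) * n) ≤ K
  six_mul : bits (6 * ((k + 1) * n)) ≤ K
  log : bits (Real.log (6 * ((k + 1) * n) / γ)) ≤ K
  sq : ∀ δ, δ = ε * ε * √2 / 54 / (k + 1) / n / 𝔡 → bits (δ * δ) ≤ K
  two_mul : ∀ δ, δ = ε * ε * √2 / 54 / (k + 1) / n / 𝔡 → bits (2 * (δ * δ)) ≤ K
  quotient : ∀ δ, δ = ε * ε * √2 / 54 / (k + 1) / n / 𝔡 →
    bits (Real.log (6 * ((k + 1) * n) / γ) / (2 * (δ * δ))) ≤ K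
  ceil : ∀ δ, δ = ε * ε * √2 / 54 / (k + 1) / n / 𝔡 →
    bits ⌈Real.log (6 * ((k + 1) * n) / γ) / (2 * (δ * δ))⌉ ≤ K

theorem sure_computeDelta {𝔡 : ℝ} (P : ParameterBudget K n I.k I.eps I.gam 𝔡)
    (hW : c.Within K) (h : c.real .dd = 𝔡) :
    (computeDelta.exec I c).Sure fun c' => c'.Within K ∧
      c'.real .delta = I.eps * I.eps * √2 / 54 / (I.k + 1) / n / 𝔡 := by
  rw [computeDelta]
  simp only [exec_block_assign, exec_block_nil, sure_pure]
  simp only [Arith.eval, Operand.eval, Config.setReal_real,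
      Function.update_self, ne_eq, reduceCtorEq, not_false_eq_true, Function.update_of_ne, h,
      Nat.cast_ofNat, Nat.cast_one, and_true]
  exact (((((((hW.setReal _ P.eps_sq).setReal _ P.root_two).setReal _ P.d₁).setReal _
    P.d₂).setReal _ P.succ).setReal _ P.d₃).setReal _ P.d₄).setReal _ P.d₅

theorem sure_computeReps {𝔡 : ℝ} (P : ParameterBudget K n I.k I.eps I.gam 𝔡)
    (hW : c.Within K) (hδ : δ = I.eps * I.eps * √2 / 54 / (I.k + 1) / n / 𝔡)
    (h : c.real .delta = δ) :
    (computeReps.exec I c).Sure fun c' => c'.Within K ∧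
      c'.real .r = ⌈Real.log (6 * ((I.k + 1) * n) / I.gam) / (2 * (δ * δ))⌉ := by
  rw [computeReps]
  simp only [exec_block_assign, exec_block_nil, sure_pure]
  simp only [Arith.eval, Operand.eval, Config.setReal_real,
      Function.update_self, ne_eq, reduceCtorEq, not_false_eq_true, Function.update_of_ne, h,
      Nat.cast_ofNat, Nat.cast_one, and_true]
  exact (((((((hW.setReal _ P.succ).setReal _ P.succ_mul).setReal _ P.six_mul).setReal _
    P.log).setReal _ (P.sq δ hδ)).setReal _ (P.two_mul δ hδ)).setReal _
    (P.quotient δ hδ)).setReal _ (P.ceil δ hδ)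

theorem sure_findPair (hW : c.Within K) {a b : Fin n} (ha : ∀ x, 0 < I.vec x ↔ x = a)
    (hb : ∀ x, I.vec x < 0 ↔ x = b) :
    (findPair.exec I c).Sure fun c' => c'.Within K ∧ c'.vertex .l1 = a ∧ c'.vertex .l2 = b := by
  refine (sure_forVertex (J := fun s (c : Config n VReg RReg) => c.Within K ∧
    (a ∈ s → c.vertex .l1 = a) ∧ (b ∈ s → c.vertex .l2 = b)) ?_ ⟨hW, by simp, by simp⟩).mono
    fun c' h => ⟨h.1, h.2.1 (Finset.mem_univ _), h.2.2 (Finset.mem_univ _)⟩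
  rintro s x - c₁ ⟨hW₁, ha₁, hb₁⟩
  refine sure_block_cons (G := fun c' => c'.Within K ∧ c'.vertex .x = x ∧
    (a ∈ insert x s → c'.vertex .l1 = a) ∧ (b ∈ s → c'.vertex .l2 = b))
    (sure_cond (fun h => ?_) fun h => ?_) ?_
  · rw [Prog.exec, sure_pure]
    have hx : x = a := by simpa [Test.Holds, Operand.eval, ha] using h
    refine ⟨(hW₁.setVertex _ _).setVertex _ _, by simp, fun _ => by simp [hx], by simpa using hb₁⟩
  · have hx : x ≠ a := by simpa [Test.Holds, Operand.eval, ← ha] using h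
    refine ⟨hW₁.setVertex _ _, by simp, fun h => ?_, by simpa using hb₁⟩
    simpa using ha₁ ((Finset.mem_insert.1 h).resolve_left hx.symm)
  · rintro c₂ ⟨hW₂, hx₂, ha₂, hb₂⟩
    refine sure_block_cons (sure_cond (fun h => ?_) fun h => ?_)
      fun c' h' => by rwa [exec_block_nil, sure_pure]
    · rw [Prog.exec, sure_pure]
      have hx : x = b := by simpa [Test.Holds, Operand.eval, hb, hx₂] using h
      exact ⟨hW₂.setVertex _ _, by simpa using ha₂, fun _ => by simp [hx₂, hx]⟩
    · have hx : x ≠ b := by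
        rw [ne_eq, ← hb]
        simpa [Test.Holds, Operand.eval, hx₂] using h
      exact ⟨hW₂, ha₂, fun h => hb₂ ((Finset.mem_insert.1 h).resolve_left hx.symm)⟩

/-- The square of the estimated norm, collected over the vertices, fits into `K` bits. -/
structure SumBudget (G : WeightedGraph n) (K : ℝ) (k r : ℕ) (a b : Fin n) : Prop where
  sum : ∀ (z : Fin n → ℤ) (s : Finset (Fin n)), (∀ i ∈ s, |z i| ≤ 2 * (k + 1) * r ^ 2) →
    bits (∑ i ∈ s, (z i / r ^ 2 * G.coefficient a b i) * (z i / r ^ 2 * G.coefficient a b i)) ≤ K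
  root : ∀ z : Fin n → ℤ, (∀ i, |z i| ≤ 2 * (k + 1) * r ^ 2) →
    bits √(∑ i, (z i / r ^ 2 * G.coefficient a b i) * (z i / r ^ 2 * G.coefficient a b i)) ≤ K

/-! ### Summation over all vertices. -/

/-- Each vertex contributes an existential witness; `Function.update` collects the witnesses of
successive rounds in one function without disturbing the sum over earlier vertices. -/
theorem sum_insert_update {s : Finset (Fin n)} {i : Fin n} (hi : i ∉ s) {β : Type*}
    (f : Fin n → β) (y : β) (F : Fin n → β → ℝ) :
    ∑ j ∈ insert i s, F j (Function.update f i y j) = (∑ j ∈ s, F j (f j)) + F i y := by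
  rw [Finset.sum_insert hi, Function.update_self, add_comm]
  congr 1
  refine Finset.sum_congr rfl fun j hj => ?_
  rw [Function.update_of_ne (ne_of_mem_of_not_mem hj hi)]

theorem sure_outerBody_frame (c : Config n VReg RReg) : (outerBody.exec I c).Sure fun c' =>
    c'.real .r = c.real .r ∧ c'.vertex .l1 = c.vertex .l1 ∧ c'.vertex .l2 = c.vertex .l2 := by
  refine Sure.and (Prog.sure_real_eq _ ?_ c)
    (Sure.and (Prog.sure_vertex_eq _ ?_ c) (Prog.sure_vertex_eq _ ?_ c))
  all_goals simp [outerBody, computeCoef, innerBody, estimateBinomial, estimateWalk, WritesReal,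
    writesReal_block_cons, writesReal_block_nil, WritesVertex, writesVertex_block_cons,
    writesVertex_block_nil]

variable {a b : Fin n}

theorem sure_forVertex_outerBody (D : DegreeBudget I.graph K)
    (B : ∀ i, Budget K I.k r (I.graph.coefficient a b i)) (S : SumBudget I.graph K I.k r a b)
    (hW : c.Within K) (hr : c.real .r = r)
    (ha : c.vertex .l1 = a) (hb : c.vertex .l2 = b) (hR : c.real .R = 0) :
    ((block [forVertex .i outerBody, assign .R (root (reg .R))]).exec I c).Sure
      fun c' => c'.Within K := by
  refine sure_block_cons (sure_forVertex (J := fun s (c : Config n VReg RReg) =>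
    (c.real .r = r ∧ c.vertex .l1 = a ∧ c.vertex .l2 = b) ∧ c.Within K ∧
    ∃ z : Fin n → ℤ, (∀ i ∈ s, |z i| ≤ 2 * (I.k + 1) * r ^ 2) ∧ c.real .R =
      ∑ i ∈ s, (z i / r ^ 2 * I.graph.coefficient a b i) *
        (z i / r ^ 2 * I.graph.coefficient a b i))
    ?_ ⟨⟨hr, ha, hb⟩, hW, 0, by simp, by simpa using hR⟩) ?_
  · rintro s i hi c₁ ⟨⟨hr₁, ha₁, hb₁⟩, hW₁, z, hz, hR₁⟩
    have hz' : ∀ y : ℤ, |y| ≤ 2 * (I.k + 1) * r ^ 2 →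
        ∀ j ∈ insert i s, |Function.update z i y j| ≤ 2 * (I.k + 1) * r ^ 2 := by
      intro y hy j hj
      rcases eq_or_ne j i with rfl | hji
      · simpa using hy
      · simpa [hji] using hz j ((Finset.mem_insert.1 hj).resolve_left hji)
    have hsum := fun y : ℤ => sum_insert_update hi z y fun j x =>
      (x / r ^ 2 * I.graph.coefficient a b j) * (x / r ^ 2 * I.graph.coefficient a b j)
    refine (Sure.and (sure_outerBody_frame _) (sure_outerBody D (hW₁.setVertex _ _) (B i)
      (by simpa using hr₁) (by simpa using ha₁) (by simpa using hb₁) (by simp) ?_)).mono ?_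
    · intro y hy
      rw [Config.setVertex_real, hR₁, ← hsum]
      exact S.sum _ _ (hz' y hy)
    · rintro c₂ ⟨⟨hr₂, ha₂, hb₂⟩, hW₂, y, hy, hR₂⟩
      refine ⟨⟨hr₂.trans (by simpa using hr₁), ha₂.trans (by simpa using ha₁),
        hb₂.trans (by simpa using hb₁)⟩, hW₂, Function.update z i y, hz' y hy, ?_⟩
      rw [hR₂, Config.setVertex_real, hR₁, ← hsum]
  · rintro c₁ ⟨-, hW₁, z, hz, hR₁⟩
    rw [exec_block_assign, exec_block_nil, sure_pure]
    simp only [Arith.eval, Operand.eval, hR₁]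
    exact hW₁.setReal _ (S.root z fun i => hz i (Finset.mem_univ i))

/-- Two descriptions of `R` are carried side by side: the integers z hold for every outcome and
bound its size, while the numbers q are close to the true coordinates outside the failure event. -/
theorem failsWithin_forVertex_outerBody (D : DegreeBudget I.graph K)
    (B : ∀ i, Budget K I.k r (I.graph.coefficient a b i)) (S : SumBudget I.graph K I.k r a b)
    (hW : c.Within K) (hr : c.real .r = r)
    (ha : c.vertex .l1 = a) (hb : c.vertex .l2 = b) (hR : c.real .R = 0)
    (hr0 : 0 < r) (hd : ∀ i, 0 < I.graph.degree i) (hδ : 0 ≤ δ) :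
    ((block [forVertex .i outerBody, assign .R (root (reg .R))]).exec I c).FailsWithin
      (fun c' => ∃ q : Fin n → ℝ, (∀ i, |q i - I.graph.walkCoordinate I.k a b i| ≤
        (I.k + 1) * (4 * δ * I.graph.coefficient a b i)) ∧ c'.real .R = √(∑ i, q i * q i))
      (n * ((I.k + 1 : ℕ) * (3 * ENNReal.ofReal (2 * Real.exp (-(2 * r * δ ^ 2)))))) := by
  rw [exec_block_cons, ← add_zero ((n : ℝ≥0∞) * _)]
  refine (failsWithin_forVertex (J := fun s (c : Config n VReg RReg) =>
    ((c.real .r = r ∧ c.vertex .l1 = a ∧ c.vertex .l2 = b) ∧ c.Within K ∧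
    ∃ z : Fin n → ℤ, (∀ i ∈ s, |z i| ≤ 2 * (I.k + 1) * r ^ 2) ∧ c.real .R =
      ∑ i ∈ s, (z i / r ^ 2 * I.graph.coefficient a b i) *
        (z i / r ^ 2 * I.graph.coefficient a b i)) ∧
    ∃ q : Fin n → ℝ, (∀ i ∈ s, |q i - I.graph.walkCoordinate I.k a b i| ≤
      (I.k + 1) * (4 * δ * I.graph.coefficient a b i)) ∧ c.real .R = ∑ i ∈ s, q i * q i)
    ?_ ⟨⟨⟨hr, ha, hb⟩, hW, 0, by simp, by simpa using hR⟩, 0, by simp, by simpa using hR⟩).bind ?_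
  · rintro s i hi c₁ ⟨⟨⟨hr₁, ha₁, hb₁⟩, hW₁, z, hz, hR₁⟩, q, hq, hRq⟩
    have hz' : ∀ y : ℤ, |y| ≤ 2 * (I.k + 1) * r ^ 2 →
        ∀ j ∈ insert i s, |Function.update z i y j| ≤ 2 * (I.k + 1) * r ^ 2 := by
      intro y hy j hj
      rcases eq_or_ne j i with rfl | hji
      · simpa using hy
      · simpa [hji] using hz j ((Finset.mem_insert.1 hj).resolve_left hji)
    have hsum := fun y : ℤ => sum_insert_update hi z y fun j x =>
      (x / r ^ 2 * I.graph.coefficient a b j) * (x / r ^ 2 * I.graph.coefficient a b j)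
    refine ((failsWithin_outerBody D (hW₁.setVertex _ _) (B i)
      (by simpa using hr₁) (by simpa using ha₁) (by simpa using hb₁) (by simp) hr0 hd hδ).and
      (Sure.and (sure_outerBody_frame _) (sure_outerBody D (hW₁.setVertex _ _) (B i)
      (by simpa using hr₁) (by simpa using ha₁) (by simpa using hb₁) (by simp) ?_))).mono ?_ le_rfl
    · intro y hy
      rw [Config.setVertex_real, hR₁, ← hsum]
      exact S.sum _ _ (hz' y hy)
    · rintro c₂ - ⟨⟨x, hx, hRx⟩, ⟨hr₂, ha₂, hb₂⟩, hW₂, y, hy, hR₂⟩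
      refine ⟨⟨⟨hr₂.trans (by simpa using hr₁), ha₂.trans (by simpa using ha₁),
        hb₂.trans (by simpa using hb₁)⟩, hW₂, Function.update z i y, hz' y hy, ?_⟩,
        Function.update q i x, fun j hj => ?_, ?_⟩
      · rw [hR₂, Config.setVertex_real, hR₁, ← hsum]
      · rcases eq_or_ne j i with rfl | hji
        · simpa using hx
        · simpa [hji] using hq j ((Finset.mem_insert.1 hj).resolve_left hji)
      · rw [hRx, Config.setVertex_real, hRq, sum_insert_update hi q x fun _ x => x * x]
  · rintro c₁ - ⟨-, q, hq, hRq⟩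
    rw [failsWithin_zero_iff, exec_block_assign, exec_block_nil, sure_pure]
    refine ⟨q, fun i => hq i (Finset.mem_univ i), ?_⟩
    simp [Arith.eval, Operand.eval, hRq]

/-- Everything that precedes the loop over the vertices. -/
def prelude : Prog VReg RReg :=
  block [computeRatio, computeDelta, computeReps, findPair, assign .R (val (const 0))]

theorem exec_program (c : Config n VReg RReg) : program.exec I c =
    (prelude.exec I c).bind fun c' =>
      (block [forVertex .i outerBody, assign .R (root (reg .R))]).exec I c' := by
  simp only [program, prelude, exec_block_cons, exec_block_nil, PMF.bind_bind, PMF.bind_pure]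

theorem sure_prelude [NeZero n] (hd : ∀ i, 0 < I.graph.degree i) (D : DegreeBudget I.graph K)
    (P : ParameterBudget K n I.k I.eps I.gam I.graph.degreeRatio)
    (hW : c.Within K) (h0 : c.real .dd = 0) (hK : 1 ≤ K)
    (hδ : δ = I.eps * I.eps * √2 / 54 / (I.k + 1) / n / I.graph.degreeRatio)
    (hr : (⌈Real.log (6 * ((I.k + 1) * n) / I.gam) / (2 * (δ * δ))⌉ : ℝ) = r)
    (ha : ∀ x, 0 < I.vec x ↔ x = a) (hb : ∀ x, I.vec x < 0 ↔ x = b) :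
    (prelude.exec I c).Sure fun c' => c'.Within K ∧ c'.real .r = r ∧ c'.vertex .l1 = a ∧
      c'.vertex .l2 = b ∧ c'.real .R = 0 := by
  rw [prelude]
  refine sure_block_cons (sure_computeRatio hd D hW h0) ?_
  rintro c₁ ⟨hW₁, hdd⟩
  refine sure_block_cons (sure_computeDelta P hW₁ hdd) ?_
  rintro c₂ ⟨hW₂, hdelta⟩
  refine sure_block_cons (sure_computeReps P hW₂ hδ (hdelta.trans hδ.symm)) ?_
  rintro c₃ ⟨hW₃, hr₃⟩
  refine sure_block_cons (Sure.and (Prog.sure_real_eq _ (y := RReg.r) ?_ _)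
    (sure_findPair hW₃ ha hb)) ?_
  · simp [findPair, WritesReal, writesReal_block_cons, writesReal_block_nil]
  rintro c₄ ⟨hr₄, hW₄, ha₄, hb₄⟩
  rw [exec_block_assign, exec_block_nil, sure_pure]
  refine ⟨hW₄.setReal _ ?_, ?_, ha₄, hb₄, by simp [Arith.eval, Operand.eval]⟩
  · simpa [Arith.eval, Operand.eval, bits] using hK
  · simpa [← hr] using hr₄.trans hr₃

end EstimateNorm

/-! ### Reversibility and the coordinates of `M_G^k v`. -/

namespace WeightedGraph

variable {n : ℕ} (G : WeightedGraph n)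

/-- With two vertices, connectedness gives each vertex an edge to another one. A single vertex
without a loop is connected and has degree 0, so nontriviality cannot be dropped. -/
theorem Connected.degree_pos {G : WeightedGraph n} (h : G.Connected) (hn : Nontrivial (Fin n)) (i : Fin n) :
    0 < G.degree i := by
  obtain ⟨j, hj⟩ := h.preconnected.exists_adj_of_nontrivial i
  rw [SimpleGraph.fromRel_adj] at hj
  have hw : 0 < G.w i j := hj.2.elim id fun h => (G.symm i j).symm ▸ h
  exact hw.trans_le (Finset.single_le_sum (fun l _ => G.nonneg i l) (Finset.mem_univ j))

/-- The walk is reversible. -/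
theorem degree_mul_transition_pow (hd : ∀ i, 0 < G.degree i) (s : ℕ) (i j : Fin n) :
    G.degree i * (G.transition ^ s) i j = G.degree j * (G.transition ^ s) j i := by
  induction s generalizing i j with
  | zero =>
    rcases eq_or_ne i j with rfl | h
    · rfl
    · simp [h, h.symm]
  | succ s ih =>
    have h1 : ∀ i l, G.degree i * G.transition i l = G.degree l * G.transition l i := by
      intro i l
      simp only [transition, Matrix.of_apply]
      rw [mul_div_cancel₀ _ (hd i).ne', mul_div_cancel₀ _ (hd l).ne', G.symm]
    rw [pow_succ, Matrix.mul_apply, ← pow_succ, pow_succ', Matrix.mul_apply, Finset.mul_sum,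
      Finset.mul_sum]
    refine Finset.sum_congr rfl fun l _ => ?_
    rw [← mul_assoc, ih, ← mul_assoc, ← h1 l j]
    ring

/-- The lazy matrix is D N E with E = D⁻¹ and N = (P + 1)/2, so its powers telescope to D N^k E and
the binomial theorem expands N^k. Reversibility then exchanges the roles of i and l: the walks start
at l, and the same two starting vertices serve every coordinate i. -/
theorem lazyMatrix_pow_apply (hd : ∀ i, 0 < G.degree i) (k : ℕ) (i l : Fin n) :
    (G.lazyMatrix ^ k) i l = ∑ s ∈ Finset.range (k + 1), (k.choose s : ℝ) / 2 ^ k *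
      (G.transition ^ s) l i * (√(G.degree l) / √(G.degree i)) := by
  set D : Matrix (Fin n) (Fin n) ℝ := Matrix.diagonal fun i => √(G.degree i) with hD
  set E : Matrix (Fin n) (Fin n) ℝ := Matrix.diagonal fun i => (√(G.degree i))⁻¹ with hE
  have hs : ∀ i, 0 < √(G.degree i) := fun i => Real.sqrt_pos.2 (hd i)
  have hED : E * D = 1 := by
    rw [hE, hD, Matrix.diagonal_mul_diagonal, ← Matrix.diagonal_one]
    congr 1
    funext i
    exact inv_mul_cancel₀ (hs i).ne'
  have hDE : D * E = 1 := by
    rw [hE, hD, Matrix.diagonal_mul_diagonal, ← Matrix.diagonal_one]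
    congr 1
    funext i
    exact mul_inv_cancel₀ (hs i).ne'
  set N : Matrix (Fin n) (Fin n) ℝ := (1 / 2 : ℝ) • (G.transition + 1) with hN
  have hM : G.lazyMatrix = D * N * E := by
    rw [lazyMatrix, hN, Matrix.mul_smul, Matrix.smul_mul, mul_add, add_mul, mul_one, hDE, add_comm]
  have hpow : ∀ k, G.lazyMatrix ^ k = D * N ^ k * E := by
    intro k
    induction k with
    | zero => simp [hDE]
    | succ k ih =>
      calc G.lazyMatrix ^ (k + 1) = D * N ^ k * (E * D) * N * E := by
            rw [pow_succ, ih, hM]; simp only [mul_assoc]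
        _ = _ := by rw [hED, mul_one, pow_succ]; simp only [mul_assoc]
  have hNk : N ^ k = ∑ s ∈ Finset.range (k + 1), ((k.choose s : ℝ) / 2 ^ k) • G.transition ^ s := by
    rw [hN, smul_pow, (Commute.one_right _).add_pow, Finset.smul_sum]
    refine Finset.sum_congr rfl fun s _ => ?_
    rw [one_pow, mul_one, ← nsmul_eq_mul', ← Nat.cast_smul_eq_nsmul ℝ, smul_smul]
    congr 1
    rw [one_div, inv_pow]
    ring
  rw [hpow, hD, hE, Matrix.mul_diagonal, Matrix.diagonal_mul, hNk, Matrix.sum_apply,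
    Finset.mul_sum, Finset.sum_mul]
  refine Finset.sum_congr rfl fun s _ => ?_
  rw [Matrix.smul_apply, smul_eq_mul]
  have := G.degree_mul_transition_pow hd s i l
  rw [← Real.mul_self_sqrt (hd i).le, ← Real.mul_self_sqrt (hd l).le] at this
  have h1 := (hs i).ne'
  have h2 := (hs l).ne'
  field_simp
  linear_combination (k.choose s : ℝ) * this

/-- The normalisation of v gives √d_a v_a = √(d_a d_b/(d_a + d_b)) = -√d_b v_b, so the two columns
of `M_G^k` that matter are combined with opposite signs and one common coefficient. -/
theorem toEuclideanLin_lazyMatrix_pow (hd : ∀ i, 0 < G.degree i) {a b : Fin n} (hab : b ≠ a)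
    {v : EuclideanSpace ℝ (Fin n)} (hb : v b = -(1 / √(1 + G.degree b / G.degree a)))
    (ha : v a = 1 / √(1 + G.degree a / G.degree b)) (h0 : ∀ l, l ≠ b → l ≠ a → v l = 0)
    (k : ℕ) (i : Fin n) :
    Matrix.toEuclideanLin (G.lazyMatrix ^ k) v i = G.walkCoordinate k a b i := by
  have hsum : Matrix.toEuclideanLin (G.lazyMatrix ^ k) v i =
      (G.lazyMatrix ^ k) i a * v a + (G.lazyMatrix ^ k) i b * v b := by
    rw [← Finset.sum_pair (f := fun l => (G.lazyMatrix ^ k) i l * v l) hab.symm]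
    refine (Finset.sum_subset (Finset.subset_univ {a, b}) fun l _ hl => ?_).symm
    simp only [Finset.mem_insert, Finset.mem_singleton, not_or] at hl
    simp [h0 l hl.2 hl.1]
  have hda := hd a
  have hdb := hd b
  have hdi := hd i
  have ea : √(G.degree a) / √(G.degree i) * v a = G.coefficient a b i := by
    rw [ha, coefficient, ← Real.sqrt_div' _ hdi.le, one_div, ← div_eq_mul_inv,
      ← Real.sqrt_div' _ (by positivity), add_comm]
  have eb : √(G.degree b) / √(G.degree i) * v b = -G.coefficient a b i := by
    rw [hb, coefficient, ← Real.sqrt_div' _ hdi.le, one_div, mul_neg, ← div_eq_mul_inv,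
      ← Real.sqrt_div' _ (by positivity)]
    congr 2
    field_simp
  rw [hsum, G.lazyMatrix_pow_apply hd, G.lazyMatrix_pow_apply hd, walkCoordinate, Finset.sum_mul,
    Finset.sum_mul, ← Finset.sum_add_distrib]
  refine Finset.sum_congr rfl fun s _ => ?_
  linear_combination (k.choose s : ℝ) / 2 ^ k * (G.transition ^ s) a i * ea +
    (k.choose s : ℝ) / 2 ^ k * (G.transition ^ s) b i * eb

/-- The square of the coefficient is at most d_a/d_i ≤ 𝔡 ≤ 𝔡². The sharper bound √𝔡 is not needed,
since δ contains the factor 1/𝔡. -/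
theorem coefficient_le (hd : ∀ i, 0 < G.degree i) (a b i : Fin n) :
    G.coefficient a b i ≤ G.degreeRatio := by
  have : NeZero n := ⟨fun h => (h ▸ a).elim0⟩
  have h1 := G.one_le_degreeRatio hd
  have hda := hd a
  have hdb := hd b
  have hdi := hd i
  rw [coefficient, Real.sqrt_le_left (by linarith)]
  calc _ ≤ G.degree a / G.degree i :=
        div_le_self (by positivity) (by linarith [div_pos hda hdb])
    _ ≤ G.degreeRatio := G.div_degree_le_degreeRatio hd a i
    _ ≤ G.degreeRatio ^ 2 := by nlinarith

end WeightedGraph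

/-- The reverse triangle inequality bounds the difference by √n τ ≤ n τ. The case n = 0 is separate
because there nothing forces τ ≥ 0. -/
theorem EuclideanSpace.abs_sqrt_sum_sub_norm_le {n : ℕ} (u : EuclideanSpace ℝ (Fin n))
    {q : Fin n → ℝ} {τ : ℝ} (h : ∀ i, |q i - u i| ≤ τ) :
    |√(∑ i, q i * q i) - ‖u‖| ≤ n * τ := by
  rcases Nat.eq_zero_or_pos n with rfl | hn
  · simp [EuclideanSpace.norm_eq]
  have hτ : 0 ≤ τ := (abs_nonneg _).trans (h ⟨0, hn⟩)
  have hq : √(∑ i, q i * q i) = ‖(WithLp.toLp 2 q : EuclideanSpace ℝ (Fin n))‖ := by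
    rw [EuclideanSpace.norm_eq]
    congr 1
    exact Finset.sum_congr rfl fun i _ => by simp [pow_two]
  rw [hq]
  refine (abs_norm_sub_norm_le _ _).trans ?_
  rw [EuclideanSpace.norm_eq, Real.sqrt_le_left (by positivity)]
  have hn1 : (1 : ℝ) ≤ n := by exact_mod_cast hn
  calc _ ≤ ∑ _i : Fin n, τ ^ 2 := by
        refine Finset.sum_le_sum fun i _ => ?_
        have := h i
        simp only [PiLp.sub_apply, Real.norm_eq_abs]
        gcongr
    _ = n * τ ^ 2 := by simp
    _ ≤ (n * τ) ^ 2 := by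
        rw [mul_pow]
        gcongr
        nlinarith

namespace RegProg

/-! ### Numbers of polynomial size -/

/-- The number `x` lies between `W ^ (-p)` and `W ^ p`. -/
def PolySized (W : ℝ) (p : ℕ) (x : ℝ) : Prop := (W ^ p)⁻¹ ≤ x ∧ x ≤ W ^ p

namespace PolySized

variable {W x y : ℝ} {p q : ℕ}

theorem pos (hW : 2 ≤ W) (h : PolySized W p x) : 0 < x :=
  lt_of_lt_of_le (by positivity) h.1

theorem mono (hW : 2 ≤ W) (h : PolySized W p x) (hpq : p ≤ q) : PolySized W q x := by
  have : W ^ p ≤ W ^ q := pow_le_pow_right₀ (by linarith) hpq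
  exact ⟨(inv_anti₀ (by positivity) this).trans h.1, h.2.trans this⟩

theorem mul (hW : 2 ≤ W) (hx : PolySized W p x) (hy : PolySized W q y) :
    PolySized W (p + q) (x * y) := by
  have := hx.pos hW
  have := hy.pos hW
  rw [PolySized, pow_add, mul_inv]
  exact ⟨mul_le_mul hx.1 hy.1 (by positivity) (by positivity),
    mul_le_mul hx.2 hy.2 (by positivity) (by positivity)⟩

theorem inv (hW : 2 ≤ W) (hx : PolySized W p x) : PolySized W p x⁻¹ := by
  have h := hx.pos hW
  exact ⟨inv_anti₀ h hx.2, by simpa using inv_anti₀ (by positivity) hx.1⟩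

theorem div (hW : 2 ≤ W) (hx : PolySized W p x) (hy : PolySized W q y) :
    PolySized W (p + q) (x / y) := hx.mul hW (hy.inv hW)

theorem of_one_le (h1 : 1 ≤ x) (hW : 2 ≤ W) (h : x ≤ W ^ p) : PolySized W p x :=
  ⟨(inv_le_one_of_one_le₀ (one_le_pow₀ (by linarith))).trans h1, h⟩

theorem add (hW : 2 ≤ W) (hx : PolySized W p x) (hy : PolySized W p y) :
    PolySized W (p + 1) (x + y) := by
  have h2 : 2 * W ^ p ≤ W ^ (p + 1) := by
    rw [pow_succ']
    gcongr
  have := hx.pos hW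
  have := hy.pos hW
  refine ⟨(hx.mono hW (Nat.le_succ p)).1.trans (by linarith), ?_⟩
  linarith [hx.2, hy.2]

theorem sqrt (hW : 2 ≤ W) (hx : PolySized W p x) : PolySized W p √x := by
  have h1 : (1 : ℝ) ≤ W ^ p := one_le_pow₀ (by linarith)
  have h2 : (W ^ p)⁻¹ ≤ 1 := inv_le_one_of_one_le₀ h1
  have h3 : 0 < (W ^ p)⁻¹ := by positivity
  refine ⟨Real.le_sqrt_of_sq_le ?_, Real.sqrt_le_iff.2 ⟨by positivity, ?_⟩⟩
  · nlinarith [hx.1]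
  · nlinarith [hx.2]

theorem ceil (hW : 2 ≤ W) (hx : PolySized W p x) : PolySized W (p + 1) ⌈x⌉ := by
  have h1 : (1 : ℝ) ≤ W ^ p := one_le_pow₀ (by linarith)
  refine of_one_le ?_ hW ?_
  · exact_mod_cast Int.one_le_ceil_iff.2 (hx.pos hW)
  · rw [pow_succ']
    nlinarith [hx.2, Int.ceil_lt_add_one x]

theorem bits_le (hW : 2 ≤ W) (h : PolySized W p |x|) : bits x ≤ 1 + p * Real.logb 2 W := by
  have hx := h.pos hW
  have hWp : (0 : ℝ) < W ^ p := by positivity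
  rw [bits, ← Real.logb_pow, add_le_add_iff_left, abs_le, ← Real.logb_inv]
  exact ⟨Real.logb_le_logb_of_le (by norm_num) (by positivity) h.1,
    Real.logb_le_logb_of_le (by norm_num) hx h.2⟩

theorem bits_le_of_le (hW : 2 ≤ W) (h : PolySized W p x) (hpq : p ≤ q) :
    bits x ≤ 1 + q * Real.logb 2 W :=
  bits_le hW ((abs_of_pos (h.pos hW)).symm ▸ h.mono hW hpq)

end PolySized

theorem bits_zero_le {W : ℝ} (hW : 2 ≤ W) (q : ℕ) : bits 0 ≤ 1 + q * Real.logb 2 W := by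
  have := Real.logb_nonneg (b := 2) (by norm_num) (by linarith : 1 ≤ W)
  have : 0 ≤ q * Real.logb 2 W := by positivity
  simpa [bits]

theorem bits_abs (x : ℝ) : bits |x| = bits x := by simp [bits]

end RegProg

/-! ### Polynomial bounds in W for every stored number. -/

namespace EstimateNorm

open RegProg

variable {n : ℕ} {G : WeightedGraph n} {W ε γ δ : ℝ} {k r : ℕ}

theorem polySized_ratio (hd : ∀ i, 0 < G.degree i) (h : G.degreeRatio ≤ W)
    (x y : Fin n) : PolySized W 1 (G.degree x / G.degree y) := by
  have h1 := G.div_degree_le_degreeRatio hd x y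
  have h2 := G.div_degree_le_degreeRatio hd y x
  have := hd x
  have := hd y
  rw [PolySized, pow_one]
  refine ⟨?_, h1.trans h⟩
  rw [← inv_div]
  exact inv_anti₀ (by positivity) (h2.trans h)

theorem polySized_coefficient (hW : 2 ≤ W) (hd : ∀ i, 0 < G.degree i) (h : G.degreeRatio ≤ W)
    (a b i : Fin n) : PolySized W 3 (G.coefficient a b i) := by
  have hr := polySized_ratio hd h
  exact ((hr a i).div hW ((hr a b).add hW (.of_one_le le_rfl hW (by linarith)))).sqrt hW

theorem degreeBudget (hW : 2 ≤ W) (hd : ∀ i, 0 < G.degree i) (h : G.degreeRatio ≤ W) {q : ℕ}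
    (hq : 3 ≤ q) : DegreeBudget G (1 + q * Real.logb 2 W) := by
  have hr := polySized_ratio hd h
  have hr1 := fun x y => (hr x y).add hW (y := 1) (.of_one_le le_rfl hW (by linarith))
  exact ⟨fun x y => (hr x y).bits_le_of_le hW (by omega),
    fun x y => (hr1 x y).bits_le_of_le hW (by omega),
    fun a b i => ((hr a i).div hW (hr1 a b)).bits_le_of_le hW (by omega),
    fun a b i => (polySized_coefficient hW hd h a b i).bits_le_of_le hW (by omega)⟩

/-- A nonzero integer has absolute value at least 1, which supplies the lower bound. Exponents: 1 +
2 + 70 = 73 for z, then 70 for the division by r² and 3 for κ; the 35 for r comes from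
`ParameterBounds.exists_reps`. -/
theorem polySized_entry (hW : 2 ≤ W) (hk : (k + 1 : ℝ) ≤ W ^ 2) (hr : PolySized W 35 r) {κ : ℝ}
    (hκ : PolySized W 3 κ) {z : ℤ} (hz : |z| ≤ 2 * (k + 1) * r ^ 2) (hz0 : z ≠ 0) :
    PolySized W 146 |z / r ^ 2 * κ| := by
  have hr2 := hr.mul hW hr
  rw [← pow_two] at hr2
  have h2 : PolySized W 1 2 := .of_one_le (by norm_num) hW (by simpa using hW)
  have hk' : PolySized W 2 (k + 1) := .of_one_le (by simp) hW hk
  have hbound := (h2.mul hW hk').mul hW hr2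
  have hzR : PolySized W 73 |(z : ℝ)| := by
    refine .of_one_le (by exact_mod_cast Int.one_le_abs hz0) hW (le_trans ?_ hbound.2)
    exact_mod_cast hz
  have := (hzR.div hW hr2).mul hW hκ
  rwa [← abs_of_pos (hr2.pos hW), ← abs_div, ← abs_of_pos (hκ.pos hW), ← abs_mul] at this

theorem polySized_square (hW : 2 ≤ W) (hk : (k + 1 : ℝ) ≤ W ^ 2) (hr : PolySized W 35 r) {κ : ℝ}
    (hκ : PolySized W 3 κ) {z : ℤ} (hz : |z| ≤ 2 * (k + 1) * r ^ 2) (hz0 : z ≠ 0) :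
    PolySized W 292 (z / r ^ 2 * κ * (z / r ^ 2 * κ)) := by
  have := polySized_entry hW hk hr hκ hz hz0
  simpa only [abs_mul_abs_self] using this.mul hW this

theorem budget (hW : 2 ≤ W) (hk : (k + 1 : ℝ) ≤ W ^ 2) (hr : PolySized W 35 r) {κ : ℝ}
    (hκ : PolySized W 3 κ) {q : ℕ} (hq : 292 ≤ q) : Budget (1 + q * Real.logb 2 W) k r κ := by
  have h0 := bits_zero_le hW q
  have hnat : ∀ {m p : ℕ}, m ≠ 0 → (m : ℝ) ≤ W ^ p → PolySized W p m := fun hm h =>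
    .of_one_le (by exact_mod_cast Nat.one_le_iff_ne_zero.2 hm) hW h
  have hA : ∀ {A : ℕ}, A ≠ 0 → A ≤ r → PolySized W 35 A := fun h0 h =>
    hnat h0 (le_trans (by exact_mod_cast h) hr.2)
  constructor
  · intro m hm
    rcases eq_or_ne m 0 with rfl | hm0
    · simpa using h0
    · exact (hnat (p := 2) hm0 (le_trans (by exact_mod_cast hm) hk)).bits_le_of_le hW (by omega)
  · intro m hm
    rcases eq_or_ne m 0 with rfl | hm0
    · simpa using h0
    · exact (hA hm0 hm).bits_le_of_le hW (by omega)
  · intro A hAr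
    rcases eq_or_ne A 0 with rfl | hA0
    · simpa using h0
    · exact ((hA hA0 hAr).div hW hr).bits_le_of_le hW (by omega)
  · intro A S hAr hSr
    rcases eq_or_ne A 0 with rfl | hA0
    · simpa using h0
    rcases eq_or_ne S 0 with rfl | hS0
    · simpa using h0
    exact (((hA hA0 hAr).div hW hr).mul hW (hA hS0 hSr)).bits_le_of_le hW (by omega)
  · intro A S hAr hSr
    rcases eq_or_ne A 0 with rfl | hA0
    · simpa using h0
    rcases eq_or_ne S 0 with rfl | hS0
    · simpa using h0
    exact ((((hA hA0 hAr).div hW hr).mul hW (hA hS0 hSr)).div hW hr).bits_le_of_le hW (by omega)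
  · intro A S hAr hSr
    rcases eq_or_ne A 0 with rfl | hA0
    · simpa using h0
    rcases eq_or_ne S 0 with rfl | hS0
    · simpa using h0
    exact (((((hA hA0 hAr).div hW hr).mul hW (hA hS0 hSr)).div hW hr).mul hW hκ).bits_le_of_le
      hW (by omega)
  · intro z hz
    rcases eq_or_ne z 0 with rfl | hz0
    · simpa using h0
    · rw [← bits_abs]
      exact (polySized_entry hW hk hr hκ hz hz0).bits_le_of_le hW (by omega)
  · intro z hz
    rcases eq_or_ne z 0 with rfl | hz0
    · simpa using h0
    · exact (polySized_square hW hk hr hκ hz hz0).bits_le_of_le hW (by omega)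

/-- Squares cannot cancel: a sum with a nonzero term is at least that term. Having at most n ≤ W
terms raises the exponent from 292 to 293, the largest one that occurs. -/
theorem sumBudget (hW : 2 ≤ W) (hd : ∀ i, 0 < G.degree i) (h : G.degreeRatio ≤ W)
    (hn : (n : ℝ) ≤ W) (hk : (k + 1 : ℝ) ≤ W ^ 2) (hr : PolySized W 35 r) {q : ℕ} (hq : 293 ≤ q)
    (a b : Fin n) : SumBudget G (1 + q * Real.logb 2 W) k r a b := by
  have key : ∀ (z : Fin n → ℤ) (s : Finset (Fin n)), (∀ i ∈ s, |z i| ≤ 2 * (k + 1) * r ^ 2) →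
      (∑ i ∈ s, (z i / r ^ 2 * G.coefficient a b i) * (z i / r ^ 2 * G.coefficient a b i) = 0) ∨
      PolySized W 293
        (∑ i ∈ s, (z i / r ^ 2 * G.coefficient a b i) * (z i / r ^ 2 * G.coefficient a b i)) := by
    intro z s hz
    by_cases h0 : ∀ i ∈ s, z i = 0
    · left
      exact Finset.sum_eq_zero fun i hi => by simp [h0 i hi]
    · right
      push Not at h0
      obtain ⟨i, hi, hzi⟩ := h0
      have hsq := fun i hi hzi => polySized_square hW hk hr
        (polySized_coefficient hW hd h a b i) (hz i hi) hzi
      refine ⟨((hsq i hi hzi).mono hW (by omega)).1.trans (Finset.single_le_sum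
        (f := fun i => (z i / r ^ 2 * G.coefficient a b i) * (z i / r ^ 2 * G.coefficient a b i))
        (fun j _ => mul_self_nonneg _) hi), ?_⟩
      calc _ ≤ ∑ i ∈ s, W ^ 292 := by
            refine Finset.sum_le_sum fun j hj => ?_
            by_cases hzj : z j = 0
            · rw [hzj]
              simp only [Int.cast_zero, zero_div, zero_mul]
              positivity
            · exact (hsq j hj hzj).2
        _ = s.card * W ^ 292 := by simp
        _ ≤ W * W ^ 292 := by
            gcongr
            refine le_trans ?_ hn
            exact_mod_cast (Finset.card_le_univ s).trans_eq (Fintype.card_fin n)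
        _ = W ^ 293 := by ring
  constructor
  · intro z s hz
    rcases key z s hz with h | h
    · rw [h]
      exact bits_zero_le hW q
    · exact h.bits_le_of_le hW hq
  · intro z hz
    rcases key z Finset.univ fun i _ => hz i with h | h
    · rw [h, Real.sqrt_zero]
      exact bits_zero_le hW q
    · exact (h.sqrt hW).bits_le_of_le hW hq

/-- The parameters are polynomially bounded in `W`. -/
structure ParameterBounds (W : ℝ) (n k : ℕ) (ε γ 𝔡 : ℝ) : Prop where
  two_le : 2 ≤ W
  two_le_size : 2 ≤ n
  size_le : n ≤ W
  succ_le : k + 1 ≤ W ^ 2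
  ratio : PolySized W 1 𝔡
  eps : PolySized W 1 ε
  gam_pos : 0 < γ
  gam_le : γ ≤ 1
  log_le : Real.log (1 / γ) ≤ W

variable {𝔡 : ℝ}

theorem ParameterBounds.polySized_succ (h : ParameterBounds W n k ε γ 𝔡) :
    PolySized W 2 (k + 1) := .of_one_le (by simp) h.two_le h.succ_le

theorem ParameterBounds.polySized_size (h : ParameterBounds W n k ε γ 𝔡) :
    PolySized W 1 n := .of_one_le (by exact_mod_cast (by linarith [h.two_le_size] : 1 ≤ n))
      h.two_le (by simpa using h.size_le)

theorem polySized_sqrt_two (hW : 2 ≤ W) : PolySized W 1 √2 :=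
  PolySized.sqrt hW (.of_one_le (by norm_num) hW (by simpa using hW))

theorem polySized_natCast_of_le {m p : ℕ} (hW : 2 ≤ W) (h1 : 1 ≤ m) (h : m ≤ 2 ^ p) :
    PolySized W p m := by
  refine .of_one_le (by exact_mod_cast h1) hW (le_trans ?_ (pow_le_pow_left₀ (by norm_num) hW p))
  exact_mod_cast h

/-- The exponent is 3 + 6 + 2 + 1 + 1 for ε²√2, 54 ≤ 2^6, k + 1, n and 𝔡. -/
theorem ParameterBounds.polySized_delta (h : ParameterBounds W n k ε γ 𝔡) :
    PolySized W 13 (ε * ε * √2 / 54 / (k + 1) / n / 𝔡) := by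
  have hW := h.two_le
  have h54 : PolySized W 6 54 := by
    simpa using polySized_natCast_of_le (m := 54) hW (by norm_num) (by norm_num)
  exact ((((((h.eps.mul hW h.eps).mul hW (polySized_sqrt_two hW)).div hW h54).div hW
    h.polySized_succ).div hW h.polySized_size).div hW h.ratio)

theorem ParameterBounds.polySized_six_mul (h : ParameterBounds W n k ε γ 𝔡) :
    PolySized W 6 (6 * ((k + 1) * n)) := by
  have hW := h.two_le
  have h6 : PolySized W 3 6 := by
    simpa using polySized_natCast_of_le (m := 6) hW (by norm_num) (by norm_num)
  exact h6.mul hW (h.polySized_succ.mul hW h.polySized_size)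

theorem ParameterBounds.polySized_log (h : ParameterBounds W n k ε γ 𝔡) :
    PolySized W 7 (Real.log (6 * ((k + 1) * n) / γ)) := by
  have hW := h.two_le
  have hY := h.polySized_six_mul
  have hY0 := hY.pos hW
  have hγ := h.gam_pos
  have hn : (2 : ℝ) ≤ n := by exact_mod_cast h.two_le_size
  have hk : (0 : ℝ) ≤ k := by positivity
  refine .of_one_le ?_ hW ?_
  -- As n ≥ 2 and γ ≤ 1, the argument is at least 12 > e, so the logarithm is at least 1.
  · rw [Real.le_log_iff_exp_le (by positivity), le_div_iff₀ hγ]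
    nlinarith [Real.exp_one_lt_d9, h.gam_le, Real.exp_pos 1]
  -- Only log(1/γ), not 1/γ, is bounded by W: the sum is below W^6 + W ≤ W^7.
  · rw [div_eq_mul_one_div, Real.log_mul hY0.ne' (by positivity)]
    have h1 := Real.log_le_sub_one_of_pos hY0
    have h2 := h.log_le
    have h3 : W ≤ W ^ 6 := le_self_pow₀ (by linarith) (by norm_num)
    have h4 : 2 * W ^ 6 ≤ W ^ 7 := by
      rw [pow_succ' W 6]
      gcongr
    linarith [hY.2]

theorem ParameterBounds.polySized_quotient (h : ParameterBounds W n k ε γ 𝔡)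
    (hδ : δ = ε * ε * √2 / 54 / (k + 1) / n / 𝔡) :
    PolySized W 34 (Real.log (6 * ((k + 1) * n) / γ) / (2 * (δ * δ))) := by
  have hW := h.two_le
  have h2 : PolySized W 1 2 := .of_one_le (by norm_num) hW (by simpa using hW)
  have hδ' : PolySized W 13 δ := hδ ▸ h.polySized_delta
  exact h.polySized_log.div hW (h2.mul hW (hδ'.mul hW hδ'))

theorem parameterBudget (h : ParameterBounds W n k ε γ 𝔡) {q : ℕ} (hq : 35 ≤ q) :
    ParameterBudget (1 + q * Real.logb 2 W) n k ε γ 𝔡 := by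
  have hW := h.two_le
  have h2 : PolySized W 1 2 := .of_one_le (by norm_num) hW (by simpa using hW)
  have h54 : PolySized W 6 54 := by
    simpa using polySized_natCast_of_le (m := 54) hW (by norm_num) (by norm_num)
  have he := h.eps.mul hW h.eps
  have h1 := he.mul hW (polySized_sqrt_two hW)
  have hd2 := h1.div hW h54
  have hd3 := hd2.div hW h.polySized_succ
  have hd4 := hd3.div hW h.polySized_size
  have hsq : ∀ δ, δ = ε * ε * √2 / 54 / (k + 1) / n / 𝔡 → PolySized W 26 (δ * δ) := by
    rintro δ rfl
    exact h.polySized_delta.mul hW h.polySized_delta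
  exact {
    eps_sq := he.bits_le_of_le hW (by omega)
    root_two := (polySized_sqrt_two hW).bits_le_of_le hW (by omega)
    d₁ := h1.bits_le_of_le hW (by omega)
    d₂ := hd2.bits_le_of_le hW (by omega)
    succ := h.polySized_succ.bits_le_of_le hW (by omega)
    d₃ := hd3.bits_le_of_le hW (by omega)
    d₄ := hd4.bits_le_of_le hW (by omega)
    d₅ := h.polySized_delta.bits_le_of_le hW (by omega)
    succ_mul := (h.polySized_succ.mul hW h.polySized_size).bits_le_of_le hW (by omega)
    six_mul := h.polySized_six_mul.bits_le_of_le hW (by omega)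
    log := h.polySized_log.bits_le_of_le hW (by omega)
    sq := fun δ hδ => (hsq δ hδ).bits_le_of_le hW (by omega)
    two_mul := fun δ hδ => (h2.mul hW (hsq δ hδ)).bits_le_of_le hW (by omega)
    quotient := fun δ hδ => (h.polySized_quotient hδ).bits_le_of_le hW (by omega)
    ceil := fun δ hδ => ((h.polySized_quotient hδ).ceil hW).bits_le_of_le hW (by omega) }

end EstimateNorm

/-! ### The number of repetitions, the union bound and the conclusion. -/

namespace EstimateNorm

open PMF RegProg Operand Arith Test Prog
open scoped ENNReal

variable {n : ℕ} {W ε γ 𝔡 δ : ℝ} {k r : ℕ}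

/-- The exponent 35 is 7 for the logarithm, 27 for 2δ² and 1 for the ceiling. -/
theorem ParameterBounds.exists_reps (h : ParameterBounds W n k ε γ 𝔡)
    (hδ : δ = ε * ε * √2 / 54 / (k + 1) / n / 𝔡) :
    ∃ r : ℕ, (⌈Real.log (6 * ((k + 1) * n) / γ) / (2 * (δ * δ))⌉ : ℝ) = r ∧ 0 < r ∧
      PolySized W 35 r ∧ Real.log (6 * ((k + 1) * n) / γ) ≤ 2 * r * δ ^ 2 := by
  have hW := h.two_le
  have hq := h.polySized_quotient hδ
  have hδ0 : 0 < δ := (hδ ▸ h.polySized_delta : PolySized W 13 δ).pos hW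
  have hceil := Int.ceil_pos.2 (hq.pos hW)
  obtain ⟨r, hr⟩ := Int.eq_ofNat_of_zero_le hceil.le
  have hrR : (⌈Real.log (6 * ((k + 1) * n) / γ) / (2 * (δ * δ))⌉ : ℝ) = r := by
    rw [hr]
    rfl
  refine ⟨r, hrR, by omega, hrR ▸ hq.ceil hW, ?_⟩
  have := Int.le_ceil (Real.log (6 * ((k + 1) * n) / γ) / (2 * (δ * δ)))
  rw [hrR, div_le_iff₀ (by positivity)] at this
  linarith

/-- There are 3n(k+1) estimates, and each fails with probability at most 2 · γ/(6n(k+1)). -/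
theorem failure_le (hn : 0 < n) (hγ : 0 < γ)
    (h : Real.log (6 * ((k + 1) * n) / γ) ≤ 2 * r * δ ^ 2) :
    (n : ℝ≥0∞) * ((k + 1 : ℕ) * (3 * ENNReal.ofReal (2 * Real.exp (-(2 * r * δ ^ 2))))) ≤
      ENNReal.ofReal γ := by
  have hn' : (0 : ℝ) < n := by exact_mod_cast hn
  have he : Real.exp (-(2 * r * δ ^ 2)) ≤ γ / (6 * ((k + 1) * n)) := by
    rw [← inv_div, ← Real.exp_log (inv_pos.2 (by positivity : 0 < 6 * ((k + 1 : ℝ) * n) / γ)),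
      Real.log_inv]
    gcongr
  rw [← ENNReal.ofReal_natCast, ← ENNReal.ofReal_natCast, ← ENNReal.ofReal_ofNat,
    ← ENNReal.ofReal_mul (by positivity), ← ENNReal.ofReal_mul (by positivity),
    ← ENNReal.ofReal_mul (by positivity)]
  refine ENNReal.ofReal_le_ofReal ?_
  calc _ ≤ (n : ℝ) * ((k + 1 : ℕ) * (3 * (2 * (γ / (6 * ((k + 1) * n)))))) := by gcongr
    _ = γ := by
      push_cast
      field_simp
      norm_num

/-- The total deviation of all coordinates stays below the precision. -/
theorem deviation_le (hn : 0 < n) (h𝔡 : 0 < 𝔡) (hε : 0 < ε) (hε1 : ε ≤ 1)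
    (hδ : δ = ε * ε * √2 / 54 / (k + 1) / n / 𝔡) :
    n * ((k + 1) * (4 * δ * 𝔡)) ≤ ε := by
  have hn' : (0 : ℝ) < n := by exact_mod_cast hn
  have : n * ((k + 1) * (4 * δ * 𝔡)) = 4 * √2 / 54 * (ε * ε) := by
    rw [hδ]
    field_simp
  rw [this]
  have h2 : √2 ≤ 2 := by
    rw [Real.sqrt_le_left (by norm_num)]
    norm_num
  have h3 : 4 * √2 / 54 ≤ 1 := by linarith
  have h4 : 0 ≤ √2 := Real.sqrt_nonneg 2
  calc 4 * √2 / 54 * (ε * ε) ≤ 1 * (ε * 1) := by gcongr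
    _ = ε := by ring

theorem run_spec [NeZero n] {G : WeightedGraph n} (hd : ∀ i, 0 < G.degree i)
    (h : ParameterBounds W n k ε γ G.degreeRatio) (hε1 : ε ≤ 1) {a b : Fin n} (hab : b ≠ a)
    {v : EuclideanSpace ℝ (Fin n)} (hb : v b = -(1 / √(1 + G.degree b / G.degree a)))
    (ha : v a = 1 / √(1 + G.degree a / G.degree b)) (h0 : ∀ l, l ≠ b → l ≠ a → v l = 0) :
    (run G k v ε γ).FailsWithin
      (fun c => |c.real .R - ‖Matrix.toEuclideanLin (G.lazyMatrix ^ k) v‖| ≤ ε)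
      (ENNReal.ofReal γ) ∧
    (run G k v ε γ).Sure fun c => c.Within (1 + (293 : ℕ) * Real.logb 2 W) := by
  have hW := h.two_le
  have hratio : G.degreeRatio ≤ W := by simpa using h.ratio.2
  obtain ⟨δ, hδ⟩ : ∃ δ, δ = ε * ε * √2 / 54 / (k + 1) / n / G.degreeRatio := ⟨_, rfl⟩
  obtain ⟨r, hr, hr0, hrW, hlog⟩ := h.exists_reps hδ
  have hn : 0 < n := NeZero.pos n
  have hδ0 : 0 ≤ δ := ((hδ ▸ h.polySized_delta : PolySized W 13 δ).pos hW).le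
  have D := degreeBudget hW hd hratio (q := 293) (by norm_num)
  have B := fun i => budget hW h.succ_le hrW (polySized_coefficient hW hd hratio a b i) (q := 293)
    (by norm_num)
  have S := sumBudget hW hd hratio h.size_le h.succ_le hrW (q := 293) le_rfl a b
  have hK : 1 ≤ 1 + (293 : ℕ) * Real.logb 2 W := by
    simpa [bits] using bits_zero_le hW 293
  have hva : 0 < v a := by
    have := hd a
    have := hd b
    rw [ha]
    positivity
  have hvb : v b < 0 := by
    have := hd a
    have := hd b
    rw [hb, neg_lt_zero]
    positivity
  have hpos : ∀ x, 0 < v x ↔ x = a := by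
    refine fun x => ⟨fun hx => ?_, fun hx => hx ▸ hva⟩
    by_contra hxa
    rcases eq_or_ne x b with rfl | hxb
    · exact hx.not_gt hvb
    · exact hx.ne' (h0 x hxb hxa)
  have hneg : ∀ x, v x < 0 ↔ x = b := by
    refine fun x => ⟨fun hx => ?_, fun hx => hx ▸ hvb⟩
    by_contra hxb
    rcases eq_or_ne x a with rfl | hxa
    · exact hx.not_gt hva
    · exact hx.ne (h0 x hxb hxa)
  have hpre := sure_prelude (I := ⟨G, v, k, ε, γ⟩) (c := Config.init n VReg RReg) (a := a) (b := b)
    hd D (parameterBudget h (q := 293) (by norm_num)) (Config.within_init hK) rfl hK hδ hr hpos hneg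
  rw [run, exec_program]
  refine ⟨?_, ?_⟩
  -- The computation of the parameters is deterministic and spends no failure probability.
  · rw [← zero_add (ENNReal.ofReal γ)]
    refine (failsWithin_zero_iff.2 hpre).bind ?_
    rintro c - ⟨hWc, hrc, hac, hbc, hRc⟩
    refine (failsWithin_forVertex_outerBody (I := ⟨G, v, k, ε, γ⟩) D B S hWc hrc hac hbc hRc hr0
      hd hδ0).mono ?_ (failure_le hn h.gam_pos hlog)
    rintro c' - ⟨q, hq, hR⟩
    rw [hR]
    refine (EuclideanSpace.abs_sqrt_sum_sub_norm_le _ (τ := (k + 1) * (4 * δ * G.degreeRatio))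
      fun i => ?_).trans (deviation_le hn (h.ratio.pos hW) (h.eps.pos hW) hε1 hδ)
    rw [G.toEuclideanLin_lazyMatrix_pow hd hab hb ha h0]
    refine (hq i).trans ?_
    have := G.coefficient_le hd a b i
    gcongr
  · refine hpre.bind ?_
    rintro c ⟨hWc, hrc, hac, hbc, hRc⟩
    exact sure_forVertex_outerBody (I := ⟨G, v, k, ε, γ⟩) D B S hWc hrc hac hbc hRc

/-- At x = 0 both sides vanish because `Real.log 0 = 0`; this is the convention for γ = 1. -/
theorem log_max_one {x : ℝ} (hx : 0 ≤ x) : Real.log (max 1 x) = max 0 (Real.log x) := by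
  rcases le_total 1 x with h | h
  · rw [max_eq_right h, max_eq_right (Real.log_nonneg h)]
  · rw [max_eq_left h, max_eq_left (Real.log_nonpos hx h), Real.log_one]

/-- All factors of W are at least 1, so each is at most the product. Taking max(1, log(1/γ)) as a
factor, rather than 1/γ, is what leads to log log(1/γ) in the space bound. -/
theorem parameterBounds (hn : 2 ≤ n) (h𝔡 : 1 ≤ 𝔡) (hε : 0 < ε) (hε1 : ε ≤ 1) (hγ : 0 < γ)
    (hγ1 : γ ≤ 1) :
    ParameterBounds (n * max (k : ℝ) 1 * 𝔡 / ε * max 1 (Real.log (1 / γ))) n k ε γ 𝔡 := by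
  have hn2 : (2 : ℝ) ≤ n := by exact_mod_cast hn
  set κ := max (k : ℝ) 1
  have hκ1 : 1 ≤ κ := le_max_right _ _
  have hκk : (k : ℝ) ≤ κ := le_max_left _ _
  set Λ := max 1 (Real.log (1 / γ))
  have hΛ1 : 1 ≤ Λ := le_max_left _ _
  have hΛl : Real.log (1 / γ) ≤ Λ := le_max_right _ _
  have hε' : 1 ≤ ε⁻¹ := (one_le_inv₀ hε).2 hε1
  rw [div_eq_mul_inv]
  set e := ε⁻¹ with he
  have h1 : 1 ≤ n * κ := by nlinarith
  have h2 : 1 ≤ n * κ * 𝔡 := one_le_mul_of_one_le_of_one_le h1 h𝔡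
  have h3 : 1 ≤ n * κ * 𝔡 * e := one_le_mul_of_one_le_of_one_le h2 hε'
  have hn1 : (1 : ℝ) ≤ n := by linarith
  have b1 : n * κ * 𝔡 * e ≤ n * κ * 𝔡 * e * Λ := le_mul_of_one_le_right (by positivity) hΛ1
  have b2 : n * κ * 𝔡 ≤ n * κ * 𝔡 * e := le_mul_of_one_le_right (by positivity) hε'
  have b3 : n * κ ≤ n * κ * 𝔡 := le_mul_of_one_le_right (by positivity) h𝔡
  have b4 : n ≤ n * κ := le_mul_of_one_le_right (by positivity) hκ1
  have b5 : κ ≤ n * κ := le_mul_of_one_le_left (by positivity) hn1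
  have b6 : 𝔡 ≤ n * κ * 𝔡 := le_mul_of_one_le_left (by positivity) h1
  have b7 : e ≤ n * κ * 𝔡 * e := le_mul_of_one_le_left (by positivity) h2
  have b8 : Λ ≤ n * κ * 𝔡 * e * Λ := le_mul_of_one_le_left (by positivity) h3
  set W := n * κ * 𝔡 * e * Λ
  have hW : 2 ≤ W := by linarith
  refine ⟨hW, hn, by linarith, ?_, .of_one_le h𝔡 hW (by rw [pow_one]; linarith), ?_, hγ, hγ1,
    by linarith⟩
  · nlinarith
  · have : PolySized W 1 e := .of_one_le hε' hW (by rw [pow_one]; linarith)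
    simpa [he] using this.inv hW

end EstimateNorm

open RegProg EstimateNorm in
theorem mainTheorem7 :
    ∃ C : ℝ, 0 < C ∧
      ∀ (n : ℕ) [NeZero n] (G : WeightedGraph n), G.Connected →
      ∀ v ∈ G.pairVectors, ∀ (k : ℕ) (ε γ : ℝ),
        0 < ε → ε ≤ 1 → 0 < γ → γ ≤ 1 →
        (ENNReal.ofReal (1 - γ) ≤
          (EstimateNorm.run G k v ε γ).toOuterMeasure
            {c | |c.real .R - ‖Matrix.toEuclideanLin (G.lazyMatrix ^ k) v‖| ≤ ε}) ∧
        (∀ c ∈ (EstimateNorm.run G k v ε γ).support,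
          c.peak ≤ C * (Real.log (n * max (k : ℝ) 1 * G.degreeRatio / ε) +
            max 0 (Real.log (Real.log (1 / γ))))) := by
  have hlog2 : 0 < Real.log 2 := Real.log_pos (by norm_num)
  -- There are 6 + 15 = 21 registers, each of at most 1 + 293 log₂ W ≤ 294 log₂ W bits, and 21 · 294
  -- = 6174.
  refine ⟨6174 / Real.log 2, by positivity, ?_⟩
  rintro n _ G hG v ⟨b, a, hab, hb, ha, h0⟩ k ε γ hε hε1 hγ hγ1
  have hd := hG.degree_pos ⟨b, a, hab⟩
  have hn : 2 ≤ n := by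
    have := Fintype.one_lt_card_iff.2 ⟨b, a, hab⟩
    rwa [Fintype.card_fin] at this
  have h𝔡 := G.one_le_degreeRatio hd
  have hP := parameterBounds (k := k) hn h𝔡 hε hε1 hγ hγ1
  obtain ⟨hacc, hspace⟩ := run_spec hd hP hε1 hab hb ha h0
  refine ⟨?_, fun c hc => ?_⟩
  · rw [← PMF.prob_eq_toOuterMeasure, ENNReal.ofReal_sub _ hγ.le, ENNReal.ofReal_one]
    exact hacc.le_prob
  · have hW := hP.two_le
    have hn0 : (0 : ℝ) < n := by exact_mod_cast (by omega : 0 < n)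
    have hnW : bits n ≤ 1 + (293 : ℕ) * Real.logb 2 _ := hP.polySized_size.bits_le_of_le hW
      (by norm_num)
    have hpeak := (hspace c hc).peak_le
    have hl : 0 ≤ Real.log (1 / γ) := Real.log_nonneg ((one_le_div hγ).2 hγ1)
    -- The bracket in the bound becomes log W.
    rw [← log_max_one hl, ← Real.log_mul (by positivity) (by positivity)]
    set W := n * max (k : ℝ) 1 * G.degreeRatio / ε * max 1 (Real.log (1 / γ))
    have hv : Fintype.card VReg = 6 := rfl
    have hr : Fintype.card RReg = 15 := rfl
    rw [hv, hr] at hpeak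
    have h1 : 1 ≤ Real.logb 2 W := by
      rw [Real.le_logb_iff_rpow_le (by norm_num) (by linarith), Real.rpow_one]
      exact hW
    rw [div_mul_eq_mul_div, mul_div_assoc, ← Real.logb]
    push_cast at hpeak hnW
    linarith
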